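/- Conventions. A tree is a partial order in which the predecessors of every node are well-ordered; the height of a node is the order type of its set of predecessors, $T_\alpha$ is the set of nodes of height $\alpha$, the height of $T$ is the least $\alpha$ with $T_\alpha=\emptyset$, and $T(s)=\{t\in T: s\le t\}$ with the inherited order. A branch is a downward closed chain. A tree satisfies the c.c.c. if all its antichains (sets of pairwise incomparable nodes) are countable. A Souslin tree is a tree of height $\omega_1$ all of whose antichains and branches are countable. A tree $T$ is normal if it has a single minimal node, every node $s$ with $\mathrm{ht}(s)+1<\mathrm{ht}(T)$ has at least two immediate successors, every node has successors in every higher non-empty level, and two nodes of limit height with the same predecessors are equal. It is $\aleph_0$-splitting if every node that is not a leaf has exactly $\aleph_0$ immediate successors. The tree product $\bigotimes_i T^i$ is $\bigcup_\alpha\prod_i T^i_\alpha$ with the componentwise order; the tree sum $\bigoplus_i T^i$ is the disjoint union of the $T^i$ together with a new common root below all of their nodes. A normal tree $T$ of height $\omega_1$ is free if for every finite non-empty set $P$ of nodes of the same height $\bigotimes_{s\in P}T(s)$ satisfies the c.c.c. For $n\ge 1$, a Souslin tree $T$ is $n$-free if for every set $P$ of exactly $n$ nodes of the same height $\bigotimes_{s\in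 P}T(s)$ satisfies the c.c.c. A tree $T$ is strongly homogeneous if there are order isomorphisms $\psi_{st}:T(s)\to T(t)$ for all $s,t\in T$ of the same height such that: $\psi_{ss}=\mathrm{id}$; $\psi_{rt}=\psi_{st}\circ\psi_{rs}$ for $r,s,t$ of the same height; if $r,s$ have the same height, $t\ge r$ and $u=\psi_{rs}(t)$, then $\psi_{tu}=\psi_{rs}\restriction T(t)$; and if $t,u$ are on the same limit level, then there are $r<t$ and $s<u$ of the same height with $\psi_{rs}(t)=u$. Theorem. Suppose that there is a normal, $\aleph_0$-splitting, strongly homogeneous Souslin tree $T$. Then: (1) for every integer $n\ge 1$ there is a normal, $\aleph_0$-splitting Souslin tree that is $n$-free but not $(n+1)$-free; (2) for every integer $n\ge 2$ there are normal, $\aleph_0$-splitting, free Souslin trees $S_0,\dots,S_{n-1}$ such that $T\cong\bigotimes_{m<n}S_m$ and such that the tree sum $\bigoplus_{m<n}S_m$ is a normal Souslin tree that is $n$-free but not $(n+1)$-free. -/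

import Mathlib

universe u v

namespace SouslinTree

/-- A (set-theoretic) tree: a partial order in which the set of predecessors of every node is
well-ordered. -/
class IsTree (T : Type u) [PartialOrder T] : Prop where
  wo : ∀ t : T, IsWellOrder (Set.Iio t) (· < ·)

theorem IsTree.comparable {T : Type u} [PartialOrder T] [IsTree T] {t a b : T}
    (ha : a < t) (hb : b < t) : a < b ∨ a = b ∨ b < a := by
  have := IsTree.wo t
  rcases trichotomous_of (fun x y : Set.Iio t => x < y) ⟨a, ha⟩ ⟨b, hb⟩ with h | h | h
  · exact Or.inl h
  · exact Or.inr (Or.inl (congrArg Subtype.val h))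
  · exact Or.inr (Or.inr h)

theorem IsTree.wellFounded (T : Type u) [PartialOrder T] [IsTree T] :
    WellFounded (fun a b : T => a < b) := by
  refine ⟨fun t => ⟨_, fun a ha => ?_⟩⟩
  have hwf : WellFounded (fun x y : Set.Iio t => x < y) := (IsTree.wo t).wf
  have key : ∀ x : Set.Iio t, Acc (fun a b : T => a < b) x.1 := by
    intro x
    induction x using hwf.induction with
    | _ x ih => exact ⟨_, fun y hy => ih ⟨y, lt_trans hy x.2⟩ hy⟩
  exact key ⟨a, ha⟩

theorem IsTree.of_wellFounded {T : Type u} [PartialOrder T]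
    (hwf : WellFounded (fun a b : T => a < b))
    (h : ∀ t a b : T, a < t → b < t → a < b ∨ a = b ∨ b < a) : IsTree T where
  wo t :=
    { wf := InvImage.wf (fun x : Set.Iio t => x.1) hwf
      trichotomous := by
        intro a b h1 h2
        rcases h t a.1 b.1 a.2 b.2 with h | h | h
        · exact absurd h h1
        · exact Subtype.ext h
        · exact absurd h h2 }

section Trees

variable (T : Type u) [PartialOrder T] [IsTree T]

variable {T} in
/-- The height of a node: the order type of its set of predecessors. -/
noncomputable def nodeHeight (t : T) : Ordinal.{u} :=
  haveI := IsTree.wo t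
  Ordinal.type (fun a b : Set.Iio t => a < b)

/-- The height of a tree: the least ordinal `α` such that the level `α` is empty. -/
noncomputable def treeHeight : Ordinal.{u} :=
  sInf {α : Ordinal.{u} | ∀ t : T, nodeHeight t ≠ α}

/-- Normal trees. -/
structure IsNormal : Prop where
  /-- there is a single minimal node, the root -/
  root : ∃! r : T, IsMin r
  /-- nodes below the top level have at least two immediate successors -/
  branching : ∀ s : T, nodeHeight s + 1 < treeHeight T → {t : T | s ⋖ t}.Nontrivial
  /-- every node has successors in every higher non-empty level -/
  extend : ∀ s : T, ∀ α : Ordinal.{u}, nodeHeight s < α → α < treeHeight T →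
    ∃ t : T, s < t ∧ nodeHeight t = α
  /-- nodes of limit height are determined by their predecessors -/
  limit_unique : ∀ s t : T, Order.IsSuccLimit (nodeHeight s) → Order.IsSuccLimit (nodeHeight t) →
    Set.Iio s = Set.Iio t → s = t

/-- `ℵ₀`-splitting trees: every node that is not a leaf has exactly `ℵ₀` immediate successors. -/
def IsAlephZeroSplitting : Prop :=
  ∀ s : T, ¬ IsMax s → Cardinal.mk {t : T | s ⋖ t} = Cardinal.aleph0

end Trees

/-- The countable chain condition: every set of pairwise incomparable elements is countable. It is
only applied to trees and tree products, where incomparable elements are exactly those that have no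
common upper bound. -/
def CCC (X : Type u) [PartialOrder X] : Prop :=
  ∀ A : Set X, IsAntichain (· ≤ ·) A → A.Countable

/-- Souslin trees: height `ω₁`, and every antichain and every branch (downward closed chain) is
countable. -/
structure IsSouslin (T : Type u) [PartialOrder T] [IsTree T] : Prop where
  height_eq : treeHeight T = Ordinal.omega 1
  ccc : CCC T
  branch_countable : ∀ b : Set T, IsChain (· ≤ ·) b → IsLowerSet b → b.Countable

/-- The set `T(s)` of nodes above (and including) `s` is a tree with the inherited order. -/
instance instIsTreeIci {T : Type u} [PartialOrder T] [IsTree T] (s : T) :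
    IsTree (Set.Ici s) :=
  IsTree.of_wellFounded (InvImage.wf (fun x : Set.Ici s => x.1) (IsTree.wellFounded T))
    (fun t a b ha hb => (IsTree.comparable (show a.1 < t.1 from ha) (show b.1 < t.1 from hb)).imp
      id (Or.imp Subtype.ext id))

section Operations

variable {ι : Type v} (S : ι → Type u) [∀ i, PartialOrder (S i)]

/-- The tree product: the union over all `α` of the cartesian products of the levels `α` of the
factors, with the componentwise order. -/
abbrev TreeProd [∀ i, IsTree (S i)] : Type (max u v) :=
  {x : ∀ i, S i // ∀ i j, nodeHeight (x i) = nodeHeight (x j)}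

/-- The tree sum: the disjoint union of the summands (nodes of different summands are
incomparable) together with a new common root `⊥` below everything. -/
abbrev TreeSum : Type (max u v) := WithBot (Σ i, S i)

instance instIsTreeSum [∀ i, IsTree (S i)] : IsTree (TreeSum S) := by
  have hsig : ∀ (i : ι) (t : S i) (p : Σ i, S i), p < ⟨i, t⟩ → ∃ s : S i, s < t ∧ p = ⟨i, s⟩ := by
    intro i t p hp
    cases hp with
    | fiber _ s _ h => exact ⟨s, h, rfl⟩
  have hacc : ∀ p : TreeSum S, Acc (· < ·) p := by
    have hbot : Acc (· < ·) (⊥ : TreeSum S) := ⟨_, fun a ha => absurd ha not_lt_bot⟩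
    have hcoe : ∀ (i : ι) (t : S i), Acc (· < ·) (((⟨i, t⟩ : Σ i, S i) : WithBot (Σ i, S i))) := by
      intro i t
      induction t using (IsTree.wellFounded (S i)).induction with
      | _ t ih =>
        refine ⟨_, fun a ha => ?_⟩
        induction a using WithBot.recBotCoe with
        | bot => exact hbot
        | coe q =>
          obtain ⟨s, h, rfl⟩ := hsig i t q (WithBot.coe_lt_coe.1 ha)
          exact ih s h
    intro p
    induction p using WithBot.recBotCoe with
    | bot => exact hbot
    | coe q => exact hcoe q.1 q.2
  refine IsTree.of_wellFounded ⟨hacc⟩ ?_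
  intro t a b ha hb
  induction a using WithBot.recBotCoe with
  | bot =>
    rcases eq_or_ne b ⊥ with h | h
    · exact Or.inr (Or.inl h.symm)
    · exact Or.inl (bot_lt_iff_ne_bot.2 h)
  | coe a =>
    induction b using WithBot.recBotCoe with
    | bot => exact Or.inr (Or.inr (WithBot.bot_lt_coe a))
    | coe b =>
      induction t using WithBot.recBotCoe with
      | bot => exact absurd ha not_lt_bot
      | coe t =>
        obtain ⟨i, t⟩ := t
        obtain ⟨a, ha', rfl⟩ := hsig i t a (WithBot.coe_lt_coe.1 ha)
        obtain ⟨b, hb', rfl⟩ := hsig i t b (WithBot.coe_lt_coe.1 hb)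
        rcases IsTree.comparable ha' hb' with h | h | h
        · exact Or.inl (WithBot.coe_lt_coe.2 (Sigma.mk_lt_mk_iff.2 h))
        · exact Or.inr (Or.inl (by cases h; rfl))
        · exact Or.inr (Or.inr (WithBot.coe_lt_coe.2 (Sigma.mk_lt_mk_iff.2 h)))

end Operations

section Notions

variable (T : Type u) [PartialOrder T] [IsTree T]

/-- A coherent family of isomorphisms `ψ_{st} : T(s) ≅ T(t)`, for `s`, `t` of the same height. -/
structure CoherentFamily where
  /-- the isomorphism `ψ_{st}` -/
  iso : ∀ s t : T, nodeHeight s = nodeHeight t → (Set.Ici s ≃o Set.Ici t)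
  iso_self : ∀ s : T, iso s s rfl = OrderIso.refl (Set.Ici s)
  /-- `ψ_{rt} = ψ_{st} ∘ ψ_{rs}` -/
  commutative : ∀ (r s t : T) (hrs : nodeHeight r = nodeHeight s)
    (hst : nodeHeight s = nodeHeight t),
    iso r t (hrs.trans hst) = (iso r s hrs).trans (iso s t hst)
  /-- If `t ≥ r` and `u = ψ_{rs}(t)` then `ψ_{tu}` is the restriction of `ψ_{rs}` to `T(t)`. (The
  equality `htu` of heights always holds; it is only needed in order to write `ψ_{tu}`.) -/
  coherent : ∀ (r s : T) (hrs : nodeHeight r = nodeHeight s) (t : Set.Ici r)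
    (htu : nodeHeight (t : T) = nodeHeight (iso r s hrs t : T)) (x : T) (hx : (t : T) ≤ x),
    (iso (t : T) (iso r s hrs t : T) htu ⟨x, hx⟩ : T) =
      (iso r s hrs ⟨x, le_trans (Set.mem_Ici.1 t.2) hx⟩ : T)
  /-- If `t`, `u` lie on the same limit level, then some `ψ_{rs}` with `r < t`, `s < u` on a common
  lower level maps `t` to `u`. -/
  transitive : ∀ t u : T, nodeHeight t = nodeHeight u → Order.IsSuccLimit (nodeHeight t) →
    ∃ (r s : T) (hrs : nodeHeight r = nodeHeight s) (hrt : r < t), s < u ∧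
      (iso r s hrs ⟨t, hrt.le⟩ : T) = u

/-- Strongly homogeneous trees. -/
def IsStronglyHomogeneous : Prop := Nonempty (CoherentFamily T)

/-- Free trees: a tree `T` (normal, of height `ω₁`) such that for every finite non-empty set `P` of
nodes of the same height the tree product of the `T(s)`, `s ∈ P`, satisfies the c.c.c. -/
structure IsFree : Prop where
  normal : IsNormal T
  height_eq : treeHeight T = Ordinal.omega 1
  prod_ccc : ∀ P : Finset T, P.Nonempty → (∃ α : Ordinal.{u}, ∀ s ∈ P, nodeHeight s = α) →
    CCC (TreeProd (fun s : {s : T // s ∈ P} => Set.Ici (s : T)))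

/-- `n`-freeness of a Souslin tree `T`: for every subset `P` of size `n` of some level of `T` the
tree product of the `T(s)`, `s ∈ P`, satisfies the c.c.c. -/
def IsNFree (n : ℕ) : Prop :=
  ∀ P : Finset T, P.card = n → (∃ α : Ordinal.{u}, ∀ s ∈ P, nodeHeight s = α) →
    CCC (TreeProd (fun s : {s : T // s ∈ P} => Set.Ici (s : T)))

end Notions

end SouslinTree

open SouslinTree

/-! Strong homogeneity presents `T` as a tree of transfinite sequences over a countable set `B` of
labels (`Labelling`): initial segments may be exchanged, and two sequences of the same limit length
agree from some point on. The set `B` is arbitrary as long as it is countably infinite, so it can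
carry algebra.

Let `V` be the vector space over the field with two elements whose basis is the set of words in the
letters `(i, k)`, and let `B` be its `n`-th power. Each column `i` has a colour `col i` among `n`
colours, and the maps `x ↦ x (col i) + stripLetter (i, k) (∑ j, x j)` form a matrix of partitions of
`B` with rows `k`. One map of each colour together give a bijection from `B` to the `n`-th power of
`V`, because stripping letters is locally nilpotent. Finitely many distinct maps that omit a colour
can be prescribed arbitrarily, because words can be planted in the coordinate of the omitted colour.

Column `i` yields a quotient of `T` (`ColTree`): the label following a node is seen only through one
partition of column `i`, and distinct classes on a level use distinct rows. If the systems of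
equations belonging to finitely many classes on one level are solvable, then all nodes of the
product above these classes are represented by grafting one single node `y` of `T` onto fixed
representatives (`exists_common_tail`). The product then inherits the c.c.c. from `T`. Any `n`
columns either show every colour exactly once or omit one, so the sum of the quotients is `n`-free;
if `n ≥ 2`, a single column omits a colour, so each quotient is free.

One column of each colour determines a node of `T`, which makes `T` the product of these quotients.
For the same reason an additional `(n+1)`-st factor is controlled by the first `n`, and an
uncountable antichain appears (`TreeSum.not_isNFree_succ`). -/

namespace SouslinTree

/-! ### Heights, restrictions and cones of nodes. -/

section Heights

variable {T : Type u} [PartialOrder T] [IsTree T]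

theorem nodeHeight_eq_typein {s t : T} (h : s < t) :
    haveI := IsTree.wo t
    nodeHeight s = Ordinal.typein (fun a b : Set.Iio t => a < b) ⟨s, h⟩ := by
  have := IsTree.wo t
  have := IsTree.wo s
  unfold nodeHeight
  symm
  refine Ordinal.type_eq.2 ⟨⟨⟨fun x => ⟨x.1.1, x.2⟩, fun x => ⟨⟨x.1, lt_trans x.2 h⟩, x.2⟩,
    fun x => rfl, fun x => rfl⟩, Iff.rfl⟩⟩

theorem nodeHeight_lt_of_lt {s t : T} (h : s < t) : nodeHeight s < nodeHeight t := by
  have := IsTree.wo t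
  rw [nodeHeight_eq_typein h]
  exact Ordinal.typein_lt_type _ _

theorem nodeHeight_mono {s t : T} (h : s ≤ t) : nodeHeight s ≤ nodeHeight t := by
  rcases h.eq_or_lt with rfl | h
  · exact le_rfl
  · exact (nodeHeight_lt_of_lt h).le

theorem exists_lt_nodeHeight_eq {t : T} {β : Ordinal.{u}} (h : β < nodeHeight t) :
    ∃ s < t, nodeHeight s = β := by
  have := IsTree.wo t
  obtain ⟨a, ha⟩ := Ordinal.typein_surj (fun a b : Set.Iio t => a < b) h
  exact ⟨a.1, a.2, (nodeHeight_eq_typein a.2).trans ha⟩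

theorem exists_le_nodeHeight_eq {t : T} {β : Ordinal.{u}} (h : β ≤ nodeHeight t) :
    ∃ s ≤ t, nodeHeight s = β := by
  rcases h.eq_or_lt with rfl | h
  · exact ⟨t, le_rfl, rfl⟩
  · obtain ⟨s, hs, h⟩ := exists_lt_nodeHeight_eq h
    exact ⟨s, hs.le, h⟩

/-- The height function is the only strictly monotone function to the ordinals that maps the
predecessors of each node onto an initial segment. -/
theorem nodeHeight_unique {h : T → Ordinal.{u}} (hmono : ∀ s t, s < t → h s < h t)
    (hsurj : ∀ t, ∀ β < h t, ∃ s < t, h s = β) (t : T) : nodeHeight t = h t := by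
  induction t using (IsTree.wellFounded T).induction with
  | _ t ih =>
  rcases lt_trichotomy (nodeHeight t) (h t) with hlt | heq | hgt
  · obtain ⟨s, hs, hs'⟩ := hsurj t _ hlt
    rw [← ih s hs] at hs'
    exact absurd hs' (nodeHeight_lt_of_lt hs).ne
  · exact heq
  · obtain ⟨s, hs, hs'⟩ := exists_lt_nodeHeight_eq hgt
    rw [ih s hs] at hs'
    exact absurd hs' (hmono _ _ hs).ne

theorem eq_of_le_of_nodeHeight_eq {s t : T} (h : s ≤ t) (hh : nodeHeight s = nodeHeight t) :
    s = t := by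
  by_contra hne
  exact (nodeHeight_lt_of_lt (lt_of_le_of_ne h hne)).ne hh

theorem IsTree.comparable_of_le {a b t : T} (ha : a ≤ t) (hb : b ≤ t) : a ≤ b ∨ b ≤ a := by
  rcases ha.eq_or_lt with rfl | ha
  · exact Or.inr hb
  rcases hb.eq_or_lt with rfl | hb
  · exact Or.inl ha.le
  rcases IsTree.comparable ha hb with h | h | h
  · exact Or.inl h.le
  · exact Or.inl h.le
  · exact Or.inr h.le

theorem le_of_le_of_nodeHeight_le {a b t : T} (ha : a ≤ t) (hb : b ≤ t)
    (h : nodeHeight a ≤ nodeHeight b) : a ≤ b := by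
  rcases IsTree.comparable_of_le ha hb with h' | h'
  · exact h'
  · exact (eq_of_le_of_nodeHeight_eq h' (le_antisymm (nodeHeight_mono h') h)).ge

/-- The node of height `β` below `t`, if `β` is at most the height of `t`. -/
noncomputable def restrict (t : T) (β : Ordinal.{u}) : T :=
  -- The default `t` makes `restrict t β ≤ t` hold for every `β`.
  open Classical in if h : β ≤ nodeHeight t then (exists_le_nodeHeight_eq h).choose else t

theorem restrict_le (t : T) (β : Ordinal.{u}) : restrict t β ≤ t := by
  unfold restrict
  split_ifs with h
  · exact (exists_le_nodeHeight_eq h).choose_spec.1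
  · exact le_rfl

theorem nodeHeight_restrict {t : T} {β : Ordinal.{u}} (h : β ≤ nodeHeight t) :
    nodeHeight (restrict t β) = β := by
  rw [restrict, dif_pos h]
  exact (exists_le_nodeHeight_eq h).choose_spec.2

theorem restrict_eq_of_le {s t : T} (h : s ≤ t) : restrict t (nodeHeight s) = s :=
  have hh := nodeHeight_restrict (nodeHeight_mono h)
  le_antisymm (le_of_le_of_nodeHeight_le (restrict_le _ _) h hh.le)
    (le_of_le_of_nodeHeight_le h (restrict_le _ _) hh.ge)

theorem restrict_eq {s t : T} (h : s ≤ t) {β : Ordinal.{u}} (hβ : nodeHeight s = β) :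
    restrict t β = s := hβ ▸ restrict_eq_of_le h

theorem restrict_restrict {t : T} {β γ : Ordinal.{u}} (hβ : β ≤ nodeHeight t) (h : γ ≤ β) :
    restrict (restrict t β) γ = restrict t γ :=
  (restrict_eq ((restrict_le _ γ).trans (restrict_le t β))
    (nodeHeight_restrict (by rwa [nodeHeight_restrict hβ]))).symm

theorem restrict_of_le {s t : T} (h : s ≤ t) {γ : Ordinal.{u}} (hγ : γ ≤ nodeHeight s) :
    restrict t γ = restrict s γ :=
  restrict_eq ((restrict_le s γ).trans h) (nodeHeight_restrict hγ)

theorem restrict_mono {t : T} {β γ : Ordinal.{u}} (h : β ≤ γ) (hγ : γ ≤ nodeHeight t) :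
    restrict t β ≤ restrict t γ := by
  rw [← restrict_restrict hγ h]
  exact restrict_le _ _

theorem covBy_iff_nodeHeight {s t : T} : s ⋖ t ↔ s ≤ t ∧ nodeHeight t = nodeHeight s + 1 := by
  constructor
  · intro h
    refine ⟨h.le, le_antisymm (not_lt.1 fun hlt => ?_)
      (Order.succ_le_of_lt (nodeHeight_lt_of_lt h.lt))⟩
    obtain ⟨r, hr, hr'⟩ := exists_lt_nodeHeight_eq hlt
    have hsr : nodeHeight s < nodeHeight r := by rw [hr']; exact lt_add_one _
    exact h.2 (lt_of_le_of_ne (le_of_le_of_nodeHeight_le h.le hr.le hsr.le)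
      (by rintro rfl; exact hsr.ne rfl)) hr
  · rintro ⟨h, hh⟩
    refine ⟨lt_of_le_of_ne h (by rintro rfl; exact (lt_add_one _).ne hh), fun r h1 h2 => ?_⟩
    have h3 := nodeHeight_lt_of_lt h2
    rw [hh] at h3
    exact (nodeHeight_lt_of_lt h1).not_ge (Order.lt_succ_iff.1 h3)

theorem nodeHeight_Ici {s : T} (x : Set.Ici s) :
    nodeHeight s + nodeHeight x = nodeHeight (x : T) := by
  have key : nodeHeight x = nodeHeight (x : T) - nodeHeight s := by
    refine nodeHeight_unique (h := fun x : Set.Ici s => nodeHeight (x : T) - nodeHeight s)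
      (fun a b hab => ?_) (fun t β hβ => ?_) x
    · have ha := nodeHeight_mono (Set.mem_Ici.1 a.2)
      have hb := nodeHeight_mono (Set.mem_Ici.1 b.2)
      have h : nodeHeight (a : T) < nodeHeight (b : T) := nodeHeight_lt_of_lt hab
      rw [← Ordinal.add_sub_cancel_of_le ha, ← Ordinal.add_sub_cancel_of_le hb] at h
      exact lt_of_add_lt_add_left h
    · have ht := nodeHeight_mono (Set.mem_Ici.1 t.2)
      have h : nodeHeight s + β < nodeHeight (t : T) := by
        rw [← Ordinal.add_sub_cancel_of_le ht]
        exact (add_lt_add_iff_left _).2 hβ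
      obtain ⟨r, hr, hr'⟩ := exists_lt_nodeHeight_eq h
      have hsr : s ≤ r := le_of_le_of_nodeHeight_le (Set.mem_Ici.1 t.2) hr.le
        (by rw [hr']; exact le_self_add)
      exact ⟨⟨r, hsr⟩, hr, by simp [hr']⟩
  rw [key, Ordinal.add_sub_cancel_of_le (nodeHeight_mono (Set.mem_Ici.1 x.2))]

theorem nodeHeight_Ici_eq_iff {U : Type u} [PartialOrder U] [IsTree U] {s : T} {s' : U}
    (h : nodeHeight s = nodeHeight s') (x : Set.Ici s) (y : Set.Ici s') :
    nodeHeight x = nodeHeight y ↔ nodeHeight (x : T) = nodeHeight (y : U) := by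
  rw [← nodeHeight_Ici x, ← nodeHeight_Ici y, h, add_right_inj]

theorem nodeHeight_orderIso {U : Type u} [PartialOrder U] [IsTree U] (e : T ≃o U) (t : T) :
    nodeHeight (e t) = nodeHeight t := by
  symm
  refine nodeHeight_unique (h := fun t => nodeHeight (e t))
    (fun s t h => nodeHeight_lt_of_lt (e.lt_iff_lt.2 h)) (fun t β hβ => ?_) t
  obtain ⟨r, hr, hr'⟩ := exists_lt_nodeHeight_eq hβ
  exact ⟨e.symm r, by rwa [e.symm_apply_lt], by simpa using hr'⟩

theorem nodeHeight_eq_zero_iff {t : T} : nodeHeight t = 0 ↔ IsMin t := by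
  constructor
  · intro h s hs
    by_contra hc
    have := nodeHeight_lt_of_lt (lt_of_le_not_ge hs hc)
    rw [h] at this
    exact not_lt_zero this
  · intro h
    by_contra hc
    obtain ⟨s, hs, -⟩ := exists_lt_nodeHeight_eq (pos_iff_ne_zero.2 hc)
    exact h.not_lt hs

theorem treeHeight_eq_of {o : Ordinal.{u}} (h1 : ∀ t : T, nodeHeight t < o)
    (h2 : ∀ α < o, ∃ t : T, nodeHeight t = α) : treeHeight T = o := by
  have hmem : o ∈ {α : Ordinal.{u} | ∀ t : T, nodeHeight t ≠ α} := fun t => (h1 t).ne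
  refine le_antisymm (csInf_le' hmem) (le_csInf ⟨o, hmem⟩ fun b hb => ?_)
  by_contra! hlt
  obtain ⟨t, ht⟩ := h2 b hlt
  exact hb t ht

theorem exists_nodeHeight_eq {α : Ordinal.{u}} (h : α < treeHeight T) :
    ∃ t : T, nodeHeight t = α := by
  have := notMem_of_lt_csInf' h
  simpa using this

theorem nodeHeight_lt_treeHeight (h0 : treeHeight T ≠ 0) (t : T) :
    nodeHeight t < treeHeight T := by
  have hne : {α : Ordinal.{u} | ∀ t : T, nodeHeight t ≠ α}.Nonempty := by
    by_contra hne
    rw [Set.not_nonempty_iff_eq_empty] at hne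
    exact h0 (by rw [treeHeight, hne, Ordinal.sInf_empty])
  by_contra! hle
  obtain ⟨s, -, hs⟩ := exists_le_nodeHeight_eq hle
  exact csInf_mem hne s hs

end Heights

/-! ### Transfer of the c.c.c., countable branches and countable levels. -/

section Countability

/-- A choice function for `R` reflects the order, so it is injective and maps antichains to
antichains. All chain conditions below are obtained from that of `T` or of a tree sum in this way,
with `R` assigning representatives. -/
theorem CCC.of_rel {X Y : Type*} [PartialOrder X] [PartialOrder Y] (hY : CCC Y)
    (R : X → Y → Prop) (hR : ∀ x, ∃ y, R x y)
    (hmono : ∀ x x' y y', R x y → R x' y' → y ≤ y' → x ≤ x') : CCC X := by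
  intro A hA
  choose ρ hρ using hR
  have hinj : Set.InjOn ρ A := by
    intro a _ b _ hab
    exact le_antisymm (hmono _ _ _ _ (hρ a) (hρ b) hab.le) (hmono _ _ _ _ (hρ b) (hρ a) hab.ge)
  refine Set.countable_of_injective_of_countable_image hinj (hY _ ?_)
  rintro _ ⟨a, ha, rfl⟩ _ ⟨b, hb, rfl⟩ hne hle
  exact hA ha hb (fun h => hne (by rw [h])) (hmono _ _ _ _ (hρ a) (hρ b) hle)

/-- At each node of the branch some immediate successor leaves the branch, and these successors form
an antichain. -/
theorem chain_countable_of_ccc {T : Type u} [PartialOrder T] [IsTree T] (hT : CCC T)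
    (hbranch : ∀ s : T, {t : T | s ⋖ t}.Nontrivial) (b : Set T) (hb : IsChain (· ≤ ·) b)
    (hlow : IsLowerSet b) : b.Countable := by
  have hex : ∀ x : T, x ∈ b → ∃ y, x ⋖ y ∧ y ∉ b := by
    intro x hx
    obtain ⟨y, hy, z, hz, hyz⟩ := hbranch x
    by_contra! hc
    have hh : nodeHeight y = nodeHeight z := by
      rw [(covBy_iff_nodeHeight.1 hy).2, (covBy_iff_nodeHeight.1 hz).2]
    rcases hb (hc y hy) (hc z hz) hyz with h | h
    · exact hyz (eq_of_le_of_nodeHeight_eq h hh)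
    · exact hyz (eq_of_le_of_nodeHeight_eq h hh.symm).symm
  choose! f hf hfb using hex
  have hkey : ∀ x ∈ b, ∀ y ∈ b, x < y → ¬ f x ≤ f y ∧ ¬ f y ≤ f x := by
    intro x hx y hy hxy
    refine ⟨fun h => ?_, fun h => (hf x hx).2 hxy ((hf y hy).lt.trans_le h)⟩
    rcases IsTree.comparable_of_le h (hf y hy).le with h' | h'
    · exact hfb x hx (hlow h' hy)
    · rcases h'.eq_or_lt with h' | h'
      · exact hfb x hx (h' ▸ hy)
      · exact (hf x hx).2 hxy h'
  have htri : ∀ x ∈ b, ∀ y ∈ b, x ≠ y → ¬ f x ≤ f y := by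
    intro x hx y hy hne
    rcases hb hx hy hne with h | h
    · exact (hkey x hx y hy (lt_of_le_of_ne h hne)).1
    · exact (hkey y hy x hx (lt_of_le_of_ne h hne.symm)).2
  refine Set.countable_of_injective_of_countable_image (f := f)
    (fun x hx y hy hxy => by_contra fun hne => htri x hx y hy hne hxy.le) (hT _ ?_)
  rintro _ ⟨x, hx, rfl⟩ _ ⟨y, hy, rfl⟩ hne
  exact htri x hx y hy fun h => hne (by rw [h])

theorem not_countable_Iio_omega_one : ¬ (Set.Iio (Ordinal.omega.{u} 1)).Countable := by
  intro h
  rw [← Cardinal.le_aleph0_iff_set_countable, Cardinal.mk_Iio_ordinal] at h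
  simp at h

theorem level_countable {T : Type u} [PartialOrder T] [IsTree T] (hT : CCC T) (α : Ordinal.{u}) :
    {t : T | nodeHeight t = α}.Countable := by
  refine hT _ ?_
  rintro s hs t ht hne hle
  exact hne (eq_of_le_of_nodeHeight_eq hle (hs.trans ht.symm))

/-- Levels are antichains, hence countable. The codes later serve to assign distinct rows to
distinct classes on a level. -/
theorem exists_injOn_levels {T : Type u} [PartialOrder T] [IsTree T] (hT : CCC T) :
    ∃ e : T → ℕ, ∀ s t, nodeHeight s = nodeHeight t → e s = e t → s = t := by
  have h : ∀ α : Ordinal.{u}, ∃ f : T → ℕ, Set.InjOn f {t : T | nodeHeight t = α} :=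
    fun α => Set.countable_iff_exists_injOn.1 (level_countable hT α)
  choose f hf using h
  refine ⟨fun t => f (nodeHeight t) t, fun s t hst h => ?_⟩
  dsimp only at h
  rw [hst] at h
  exact hf (nodeHeight t) hst rfl h

end Countability

/-! ### A matrix of partitions of a countable vector space. -/

section Matrix

variable {ι : Type} {n : ℕ}

/-- A countably infinite vector space with a basis consisting of words in the alphabet `ι × ℕ`. -/
abbrev WordSpace (ι : Type) : Type := List (ι × ℕ) →₀ ZMod 2

/-- The linear map that strips the first letter `l` of a word, and annihilates all words that do
not begin with `l`. -/
noncomputable def stripLetter (l : ι × ℕ) : WordSpace ι →ₗ[ZMod 2] WordSpace ι :=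
  Finsupp.lcomapDomain (fun w => l :: w) (List.cons_injective)

/-- The linear map that prepends the letter `l` to every word. -/
noncomputable def addLetter (l : ι × ℕ) : WordSpace ι →ₗ[ZMod 2] WordSpace ι :=
  Finsupp.lmapDomain _ _ (fun w => l :: w)

theorem stripLetter_apply (l : ι × ℕ) (x : WordSpace ι) (w : List (ι × ℕ)) :
    stripLetter l x w = x (l :: w) := rfl

theorem stripLetter_addLetter_self (l : ι × ℕ) (x : WordSpace ι) :
    stripLetter l (addLetter l x) = x := by
  ext w
  rw [stripLetter_apply]
  exact Finsupp.mapDomain_apply List.cons_injective x w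

theorem stripLetter_addLetter_of_ne {l l' : ι × ℕ} (h : l ≠ l') (x : WordSpace ι) :
    stripLetter l (addLetter l' x) = 0 := by
  ext w
  rw [stripLetter_apply]
  refine Finsupp.mapDomain_of_notMem_range x _ ?_
  rintro ⟨w', hw'⟩
  exact h (List.cons.inj hw').1.symm

/-- The entries of the matrix of partitions of `Fin n → WordSpace ι`: the partition with index
`(i, k)` is the partition into the fibres of this map. -/
noncomputable def partitionMap (col : ι → Fin n) (i : ι) (k : ℕ) (x : Fin n → WordSpace ι) :
    WordSpace ι :=
  x (col i) + stripLetter (i, k) (∑ j, x j)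

/-- `1 + N` is bijective if `N` is locally nilpotent. -/
theorem bijective_one_add_of_locally_nilpotent {R M : Type*} [Ring R] [AddCommGroup M]
    [Module R M] (N : Module.End R M) (hN : ∀ x, ∃ L : ℕ, (N ^ L) x = 0) :
    Function.Bijective (1 + N : Module.End R M) := by
  constructor
  · refine (injective_iff_map_eq_zero (1 + N : Module.End R M)).2 fun x hx => ?_
    have hx : x + N x = 0 := hx
    -- Since `N x = -x`, the powers of `N` only change the sign of `x`.
    have key : ∀ L : ℕ, (N ^ L) x = 0 → x = 0 := by
      intro L
      induction L with
      | zero => exact fun h => h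
      | succ L ih =>
        intro h
        refine ih ?_
        rw [pow_succ, Module.End.mul_apply, ← neg_eq_of_add_eq_zero_right hx, map_neg,
          neg_eq_zero] at h
        exact h
    obtain ⟨L, hL⟩ := hN x
    exact key L hL
  · intro y
    obtain ⟨L, hL⟩ := hN y
    -- The geometric series for the inverse of `1 + N`, which is finite at `y`.
    refine ⟨(∑ i ∈ Finset.range L, (-N) ^ i) y, ?_⟩
    rw [← Module.End.mul_apply, ← sub_neg_eq_add, mul_neg_geom_sum, LinearMap.sub_apply, neg_pow,
      Module.End.mul_apply, hL]
    simp

/-- The linear part of the transversal `i : Fin n → ι`, `k : Fin n → ℕ` of the matrix. -/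
noncomputable def transversalMap (i : Fin n → ι) (k : Fin n → ℕ) :
    Module.End (ZMod 2) (Fin n → WordSpace ι) :=
  LinearMap.pi fun m => (stripLetter (i m, k m)).comp (∑ j, LinearMap.proj j)

theorem transversalMap_apply (i : Fin n → ι) (k : Fin n → ℕ) (x : Fin n → WordSpace ι)
    (m : Fin n) : transversalMap i k x m = stripLetter (i m, k m) (∑ j, x j) := by
  simp [transversalMap]

/-- Every application removes a letter from each surviving word, so the support is exhausted after
more steps than the longest word has letters. -/
theorem transversalMap_locally_nilpotent (i : Fin n → ι) (k : Fin n → ℕ)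
    (x : Fin n → WordSpace ι) : ∃ L : ℕ, (transversalMap i k ^ L) x = 0 := by
  have hpow : ∀ L : ℕ, ∀ (B : ℕ) (x : Fin n → WordSpace ι),
      (∀ m w, B + L ≤ List.length w → x m w = 0) →
      ∀ m w, B ≤ List.length w → (transversalMap i k ^ L) x m w = 0 := by
    intro L
    induction L with
    | zero => intro B x hx m w hw; exact hx m w hw
    | succ L ih =>
      intro B x hx m w hw
      rw [pow_succ, Module.End.mul_apply]
      refine ih B _ ?_ m w hw
      intro m w hw
      rw [transversalMap_apply, stripLetter_apply, Finsupp.finsetSum_apply]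
      refine Finset.sum_eq_zero fun j _ => hx j _ ?_
      simp only [List.length_cons]
      omega
  refine ⟨(Finset.univ.sup fun m => (x m).support.sup List.length) + 1, ?_⟩
  ext1 m
  ext1 w
  refine hpow _ 0 x ?_ m w (Nat.zero_le _)
  intro m w hw
  by_contra hne
  have h1 : List.length w ≤ (x m).support.sup List.length :=
    Finset.le_sup (f := List.length) (Finsupp.mem_support_iff.2 hne)
  have h2 : (x m).support.sup List.length ≤ Finset.univ.sup fun m => (x m).support.sup List.length :=
    Finset.le_sup (f := fun m => (x m).support.sup List.length) (Finset.mem_univ m)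
  omega

/-- One entry from each column of the matrix: the partitions have exactly one point in common. -/
theorem partitionMap_bijective (col : ι → Fin n) (i : Fin n → ι) (hi : ∀ m, col (i m) = m)
    (k : Fin n → ℕ) :
    Function.Bijective fun (x : Fin n → WordSpace ι) m => partitionMap col (i m) (k m) x := by
  have h := bijective_one_add_of_locally_nilpotent _ (transversalMap_locally_nilpotent i k)
  convert h using 1
  funext x m
  simp [partitionMap, hi, transversalMap_apply]

/-- Finitely many entries of the matrix avoiding one column are independent. -/
theorem partitionMap_independent (col : ι → Fin n) {I : Type*} [Finite I] (i : I → ι) (k : I → ℕ)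
    (hinj : ∀ a b, i a = i b → k a = k b → a = b) (m₀ : Fin n) (hm : ∀ a, col (i a) ≠ m₀)
    (c : I → WordSpace ι) : ∃ x, ∀ a, partitionMap col (i a) (k a) x = c a := by
  have := Fintype.ofFinite I
  classical
  -- The only non-zero coordinate has the omitted colour, so the summand `x (col (i a))` vanishes,
  -- and stripping `(i a, k a)` recovers `c a` because the letters are distinct.
  refine ⟨Pi.single m₀ (∑ a, addLetter (i a, k a) (c a)), fun a => ?_⟩
  rw [partitionMap, Pi.single_eq_of_ne (hm a), zero_add, Finset.sum_pi_single',
    if_pos (Finset.mem_univ _), map_sum, Finset.sum_eq_single a, stripLetter_addLetter_self]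
  · intro b _ hb
    refine stripLetter_addLetter_of_ne (fun h => hb ?_) _
    exact (hinj a b (Prod.ext_iff.1 h).1 (Prod.ext_iff.1 h).2).symm
  · simp

/-- A finite family of columns for which all systems of equations with distinct rows can be
solved. -/
def Solvable {ι B V : Type} (f : ι → ℕ → B → V) {I : Type*} (i : I → ι) : Prop :=
  ∀ k : I → ℕ, (∀ a b, i a = i b → k a = k b → a = b) →
    ∀ c : I → V, ∃ x, ∀ a, f (i a) (k a) x = c a

theorem solvable_of_ne (col : ι → Fin n) {I : Type*} [Finite I] (i : I → ι) (m₀ : Fin n)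
    (hm : ∀ a, col (i a) ≠ m₀) : Solvable (partitionMap col) i :=
  fun k hk c => partitionMap_independent col i k hk m₀ hm c

theorem solvable_of_leftInverse (col : ι → Fin n) (i : Fin n → ι) (hi : ∀ m, col (i m) = m) :
    Solvable (partitionMap col) i := fun k _ c => by
  obtain ⟨x, hx⟩ := (partitionMap_bijective col i hi k).2 c
  exact ⟨x, fun a => congrFun hx a⟩

/-- Here the number `n` enters: `n` columns either show each colour exactly once, or omit a colour.
-/
theorem solvable_of_card (col : ι → Fin n) {I : Type*} [Finite I] (hI : Nat.card I = n)
    (i : I → ι) : Solvable (partitionMap col) i := by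
  by_cases h : Function.Surjective fun a => col (i a)
  · have hb : Function.Bijective fun a => col (i a) :=
      (Nat.bijective_iff_surjective_and_card _).2 ⟨h, by simp [hI]⟩
    intro k hk c
    let e := Equiv.ofBijective _ hb
    obtain ⟨x, hx⟩ := solvable_of_leftInverse col (fun m => i (e.symm m))
      (fun m => e.apply_symm_apply m) (fun m => k (e.symm m))
      (fun a b hab hk' => e.symm.injective (hk _ _ hab hk')) (fun m => c (e.symm m))
    exact ⟨x, fun a => by simpa using hx (e a)⟩
  · simp only [Function.Surjective, not_forall, not_exists] at h
    obtain ⟨m₀, h⟩ := h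
    exact solvable_of_ne col i m₀ h

end Matrix

/-! ### Labellings obtained from coherent families of isomorphisms. -/

section Labelling

/-- A labelling of a tree presents its nodes as transfinite sequences in `B`. The sequences are
closed under end-extension by elements of `B` and under exchange of initial segments, and any two
sequences of the same limit length have a common tail. -/
structure Labelling (T : Type u) [PartialOrder T] [IsTree T] (B : Type) where
  /-- the sequence of labels of a node -/
  lab : T → Ordinal.{u} → B
  /-- the sequence `t` with its initial segment replaced by `s` -/
  graft : T → T → T
  /-- the one-element extensions of a sequence -/
  snoc : T → B → T
  lab_of_le : ∀ {s t : T} {γ : Ordinal.{u}}, s ≤ t → γ < nodeHeight s → lab t γ = lab s γ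
  ext : ∀ {s t : T}, nodeHeight s = nodeHeight t → (∀ γ < nodeHeight s, lab s γ = lab t γ) → s = t
  tail : ∀ {s t : T}, nodeHeight s = nodeHeight t → Order.IsSuccLimit (nodeHeight s) →
    ∃ β < nodeHeight s, ∀ γ, β ≤ γ → γ < nodeHeight s → lab s γ = lab t γ
  le_graft : ∀ {s t : T}, nodeHeight s ≤ nodeHeight t → s ≤ graft s t
  nodeHeight_graft : ∀ {s t : T}, nodeHeight s ≤ nodeHeight t →
    nodeHeight (graft s t) = nodeHeight t
  lab_graft : ∀ {s t : T} {γ : Ordinal.{u}}, nodeHeight s ≤ γ → γ < nodeHeight t →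
    lab (graft s t) γ = lab t γ
  le_snoc : ∀ (t : T) (b : B), t ≤ snoc t b
  nodeHeight_snoc : ∀ (t : T) (b : B), nodeHeight (snoc t b) = nodeHeight t + 1
  lab_snoc : ∀ (t : T) (b : B), lab (snoc t b) (nodeHeight t) = b

theorem coe_apply_congr {T B : Type*} {p : T → T → Prop}
    (e : ∀ a : T, {x : T | p a x} → B) {a b : T} (h : a = b) {x y : T} (hx : p a x) (hy : p b y)
    (hxy : x = y) : e a ⟨x, hx⟩ = e b ⟨y, hy⟩ := by
  subst h
  subst hxy
  rfl

variable {T : Type u} [PartialOrder T] [IsTree T]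

theorem CoherentFamily.iso_congr (C : CoherentFamily T) {r s s' : T}
    (h : nodeHeight r = nodeHeight s) (h' : nodeHeight r = nodeHeight s') (hs : s = s')
    (x : Set.Ici r) : (C.iso r s h x : T) = C.iso r s' h' x := by
  subst hs
  rfl

theorem CoherentFamily.nodeHeight_iso (C : CoherentFamily T) {r s : T}
    (h : nodeHeight r = nodeHeight s) (x : Set.Ici r) :
    nodeHeight (C.iso r s h x : T) = nodeHeight (x : T) := by
  rw [← nodeHeight_Ici x, ← nodeHeight_Ici (C.iso r s h x), nodeHeight_orderIso, h]

theorem CoherentFamily.covBy_iso (C : CoherentFamily T) {r s : T}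
    (h : nodeHeight r = nodeHeight s) {p x : T} (hp : r ≤ p) (hx : p ⋖ x) :
    (C.iso r s h ⟨p, hp⟩ : T) ⋖ C.iso r s h ⟨x, hp.trans hx.le⟩ := by
  rw [covBy_iff_nodeHeight] at hx ⊢
  refine ⟨?_, ?_⟩
  · exact (C.iso r s h).monotone (show (⟨p, hp⟩ : Set.Ici r) ≤ ⟨x, hp.trans hx.1⟩ from hx.1)
  · rw [C.nodeHeight_iso, C.nodeHeight_iso]
    exact hx.2

theorem CoherentFamily.coe_iso_self (C : CoherentFamily T) {r s : T}
    (h : nodeHeight r = nodeHeight s) : (C.iso r s h ⟨r, Set.mem_Ici.2 le_rfl⟩ : T) = s := by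
  refine (eq_of_le_of_nodeHeight_eq (Set.mem_Ici.1 (C.iso r s h _).2) ?_).symm
  rw [C.nodeHeight_iso, h]

theorem CoherentFamily.restrict_iso (C : CoherentFamily T) {r s t : T}
    (h : nodeHeight r = nodeHeight s) (hrt : r ≤ t) {γ : Ordinal.{u}} (hr : r ≤ restrict t γ)
    (h2 : γ ≤ nodeHeight t) :
    restrict (C.iso r s h ⟨t, hrt⟩ : T) γ = C.iso r s h ⟨restrict t γ, hr⟩ := by
  refine restrict_eq ?_ ?_
  · exact (C.iso r s h).monotone
      (show (⟨restrict t γ, hr⟩ : Set.Ici r) ≤ ⟨t, hrt⟩ from restrict_le t γ)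
  · rw [C.nodeHeight_iso]
    exact nodeHeight_restrict h2

/-- The immediate successors of all nodes can be enumerated uniformly. -/
theorem CoherentFamily.exists_uniform_enumeration [Nonempty T] (C : CoherentFamily T) {B : Type}
    (e : ∀ s : T, {t : T | s ⋖ t} ≃ B) :
    ∃ ε : ∀ s : T, {t : T | s ⋖ t} ≃ B, ∀ (s s' : T) (h : nodeHeight s = nodeHeight s') (x : T)
      (hx : s ⋖ x) (hx' : s' ⋖ C.iso s s' h ⟨x, hx.le⟩), ε s' ⟨_, hx'⟩ = ε s ⟨x, hx⟩ := by
  have hr : ∃ r : Ordinal.{u} → T, ∀ t, nodeHeight t = nodeHeight (r (nodeHeight t)) :=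
    ⟨fun α => Classical.epsilon fun s => α = nodeHeight s,
      fun t => Classical.epsilon_spec (p := fun s => nodeHeight t = nodeHeight s) ⟨t, rfl⟩⟩
  obtain ⟨r, hr⟩ := hr
  have hcov : ∀ {s s' : T} (h : nodeHeight s = nodeHeight s') {x : T} (hx : s ⋖ x),
      s' ⋖ C.iso s s' h ⟨x, hx.le⟩ := by
    intro s s' h x hx
    have := C.covBy_iso h le_rfl hx
    rwa [C.coe_iso_self h] at this
  have hinv : ∀ {s s' : T} (h : nodeHeight s = nodeHeight s') (x : Set.Ici s),
      C.iso s' s h.symm (C.iso s s' h x) = x := by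
    intro s s' h x
    have := C.commutative s s' s h h.symm
    rw [C.iso_self] at this
    exact (DFunLike.congr_fun this x).symm
  -- The successors of `s` are enumerated by transport to the chosen representative of the level;
  -- commutativity makes this invariant under all isomorphisms of the family.
  let E : ∀ s : T, {t : T | s ⋖ t} ≃ {t : T | r (nodeHeight s) ⋖ t} := fun s =>
    { toFun := fun x => ⟨C.iso s _ (hr s) ⟨x.1, x.2.le⟩, hcov (hr s) x.2⟩
      invFun := fun x => ⟨C.iso _ s (hr s).symm ⟨x.1, x.2.le⟩, hcov (hr s).symm x.2⟩
      left_inv := by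
        intro x
        apply Subtype.ext
        have h := congrArg Subtype.val (hinv (hr s) ⟨x.1, x.2.le⟩)
        exact h
      right_inv := by
        intro x
        apply Subtype.ext
        have h := congrArg Subtype.val (hinv (hr s).symm ⟨x.1, x.2.le⟩)
        exact h }
  refine ⟨fun s => (E s).trans (e _), fun s s' h x hx hx' => ?_⟩
  refine coe_apply_congr (p := fun a x => a ⋖ x) (fun a => e a) (by rw [h]) _ _ ?_
  have h1 := DFunLike.congr_fun (C.commutative s s' _ h (hr s')) ⟨x, hx.le⟩
  refine (congrArg Subtype.val h1).symm.trans ?_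
  exact C.iso_congr _ _ (by rw [h]) _

/-- Induction on the height: the root is unique, labels distinguish immediate successors, and
normality determines nodes of limit height by their predecessors. -/
theorem IsNormal.ext_of_labels {X : Type*} (hT : IsNormal T) (L : T → T → X)
    (hL : ∀ p x y, p ⋖ x → p ⋖ y → L p x = L p y → x = y) {s t : T}
    (hst : nodeHeight s = nodeHeight t)
    (h : ∀ γ < nodeHeight s, L (restrict s γ) (restrict s (γ + 1)) =
      L (restrict t γ) (restrict t (γ + 1))) : s = t := by
  have key : ∀ (α : Ordinal.{u}) (s t : T), nodeHeight s = α → nodeHeight t = α →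
      (∀ γ < α, L (restrict s γ) (restrict s (γ + 1)) =
        L (restrict t γ) (restrict t (γ + 1))) → s = t := by
    intro α
    induction α using WellFoundedLT.induction with
    | _ α ih =>
    intro s t hs ht h
    have hres : ∀ γ < α, restrict s γ = restrict t γ := by
      intro γ hγ
      refine ih γ hγ _ _ (nodeHeight_restrict (hs ▸ hγ.le)) (nodeHeight_restrict (ht ▸ hγ.le))
        fun δ hδ => ?_
      have hδ' : δ + 1 ≤ γ := Order.add_one_le_of_lt hδ
      rw [restrict_restrict (hs ▸ hγ.le) hδ.le, restrict_restrict (hs ▸ hγ.le) hδ',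
        restrict_restrict (ht ▸ hγ.le) hδ.le, restrict_restrict (ht ▸ hγ.le) hδ']
      exact h δ (hδ.trans hγ)
    rcases Ordinal.zero_or_succ_or_isSuccLimit α with h0 | ⟨β, rfl⟩ | hlim
    · obtain ⟨r, -, hr⟩ := hT.root
      rw [hr s (nodeHeight_eq_zero_iff.1 (hs.trans h0)),
        hr t (nodeHeight_eq_zero_iff.1 (ht.trans h0))]
    · have hβ : β < Order.succ β := Order.lt_succ β
      have h1 := h β hβ
      rw [hres β hβ, ← Order.succ_eq_add_one, restrict_eq le_rfl hs, restrict_eq le_rfl ht] at h1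
      refine hL _ _ _ ?_ ?_ h1
      · rw [← hres β hβ, covBy_iff_nodeHeight, nodeHeight_restrict (hs ▸ hβ.le)]
        exact ⟨restrict_le _ _, hs⟩
      · rw [covBy_iff_nodeHeight, nodeHeight_restrict (ht ▸ hβ.le)]
        exact ⟨restrict_le _ _, ht⟩
    · refine hT.limit_unique s t (hs ▸ hlim) (ht ▸ hlim) ?_
      have aux : ∀ s t : T, nodeHeight s = α → nodeHeight t = α →
          (∀ γ < α, restrict s γ = restrict t γ) → Set.Iio s ⊆ Set.Iio t := by
        intro s t hs ht hres x hx
        have hxα : nodeHeight x < α := hs ▸ nodeHeight_lt_of_lt hx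
        have h2 : x ≤ t := by
          rw [← restrict_eq_of_le (le_of_lt hx), hres _ hxα]
          exact restrict_le _ _
        exact lt_of_le_of_ne h2 (by rintro rfl; exact hxα.ne ht)
      exact (aux s t hs ht hres).antisymm (aux t s ht hs fun γ hγ => (hres γ hγ).symm)
  exact key _ s t rfl hst.symm h

theorem CoherentFamily.nonempty_labelling [Nonempty T] (hT : IsNormal T) (C : CoherentFamily T)
    {B : Type} [Nonempty B] (e : ∀ s : T, {t : T | s ⋖ t} ≃ B) : Nonempty (Labelling T B) := by
  classical
  obtain ⟨ε, hε⟩ := C.exists_uniform_enumeration e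
  let L : T → T → B := fun p x => if h : p ⋖ x then ε p ⟨x, h⟩ else Classical.arbitrary B
  have hL : ∀ p x (h : p ⋖ x), L p x = ε p ⟨x, h⟩ := fun p x h => dif_pos h
  have hLinj : ∀ p x y, p ⋖ x → p ⋖ y → L p x = L p y → x = y := by
    intro p x y hx hy h
    rw [hL p x hx, hL p y hy] at h
    exact congrArg Subtype.val ((ε p).injective h)
  have hcov : ∀ {t : T} {γ : Ordinal.{u}}, γ < nodeHeight t →
      restrict t γ ⋖ restrict t (γ + 1) := by
    intro t γ h
    rw [covBy_iff_nodeHeight, nodeHeight_restrict h.le,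
      nodeHeight_restrict (Order.add_one_le_of_lt h)]
    exact ⟨restrict_mono le_self_add (Order.add_one_le_of_lt h), rfl⟩
  -- The isomorphism from `T(r)` to `T(s)` preserves labels from the height of `r` on: by coherence
  -- its restriction to a higher cone again belongs to the family, and the enumeration is invariant.
  have hiso : ∀ {r s t : T} (h : nodeHeight r = nodeHeight s) (hrt : r ≤ t) {γ : Ordinal.{u}},
      nodeHeight r ≤ γ → γ < nodeHeight t →
      L (restrict (C.iso r s h ⟨t, hrt⟩ : T) γ) (restrict (C.iso r s h ⟨t, hrt⟩ : T) (γ + 1)) =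
        L (restrict t γ) (restrict t (γ + 1)) := by
    intro r s t h hrt γ h1 h2
    have h3 : γ + 1 ≤ nodeHeight t := Order.add_one_le_of_lt h2
    have hr1 : r ≤ restrict t γ := le_of_le_of_nodeHeight_le hrt (restrict_le _ _)
      (by rwa [nodeHeight_restrict h2.le])
    have hr2 : r ≤ restrict t (γ + 1) := hr1.trans (hcov h2).le
    rw [C.restrict_iso h hrt hr1 h2.le, C.restrict_iso h hrt hr2 h3]
    have hc := C.covBy_iso h hr1 (hcov h2)
    have hco := C.coherent r s h ⟨restrict t γ, hr1⟩ (C.nodeHeight_iso h _).symm _ (hcov h2).le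
    rw [hL _ _ hc, hL _ _ (hcov h2)]
    have hc' := hc
    rw [← hco] at hc'
    rw [← hε _ _ (C.nodeHeight_iso h _).symm _ (hcov h2) hc']
    exact congrArg _ (Subtype.ext hco.symm)
  -- Grafting `s` onto `t` moves `t` by the isomorphism from the cone of its restriction to the cone
  -- of `s`.
  let G : T → T → T := fun s t => if h : nodeHeight s ≤ nodeHeight t then
    C.iso (restrict t (nodeHeight s)) s (nodeHeight_restrict h) ⟨t, restrict_le _ _⟩ else t
  have hG : ∀ {s t : T} (h : nodeHeight s ≤ nodeHeight t), G s t =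
      C.iso (restrict t (nodeHeight s)) s (nodeHeight_restrict h) ⟨t, restrict_le _ _⟩ :=
    fun h => dif_pos h
  refine ⟨{ lab := fun t γ => L (restrict t γ) (restrict t (γ + 1)), graft := G,
            snoc := fun t b => ((ε t).symm b).1, lab_of_le := ?_, ext := ?_, tail := ?_,
            le_graft := ?_, nodeHeight_graft := ?_, lab_graft := ?_, le_snoc := ?_,
            nodeHeight_snoc := ?_, lab_snoc := ?_ }⟩
  · intro s t γ hst hγ
    rw [restrict_of_le hst hγ.le, restrict_of_le hst (Order.add_one_le_of_lt hγ)]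
  · intro s t hst h
    exact hT.ext_of_labels L hLinj hst h
  · intro s t hst hlim
    obtain ⟨r, s', hrs, hrt, -, rfl⟩ := C.transitive s t hst hlim
    exact ⟨nodeHeight r, nodeHeight_lt_of_lt hrt, fun γ h1 h2 => (hiso hrs hrt.le h1 h2).symm⟩
  · intro s t h
    rw [hG h]
    exact Set.mem_Ici.1 (C.iso _ s _ _).2
  · intro s t h
    rw [hG h]
    exact C.nodeHeight_iso _ _
  · intro s t γ h1 h2
    have h := h1.trans h2.le
    rw [hG h]
    exact hiso _ _ (by rwa [nodeHeight_restrict h]) h2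
  · intro t b
    exact ((ε t).symm b).2.le
  · intro t b
    exact (covBy_iff_nodeHeight.1 ((ε t).symm b).2).2
  · intro t b
    have h := ((ε t).symm b).2
    have h' := (covBy_iff_nodeHeight.1 h)
    rw [restrict_eq h'.1 rfl, restrict_eq le_rfl h'.2, hL _ _ h]
    simp

end Labelling

/-! ### The quotient of the tree given by one column of partitions. -/

section ColumnTree

variable {T : Type u} [PartialOrder T] [IsTree T] {B V : Type}

namespace Labelling

theorem le_iff (D : Labelling T B) {s t : T} : s ≤ t ↔
    nodeHeight s ≤ nodeHeight t ∧ ∀ γ < nodeHeight s, D.lab s γ = D.lab t γ := by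
  constructor
  · exact fun h => ⟨nodeHeight_mono h, fun γ hγ => (D.lab_of_le h hγ).symm⟩
  · rintro ⟨h, hl⟩
    have hh := nodeHeight_restrict h
    have : s = restrict t (nodeHeight s) := by
      refine D.ext hh.symm fun γ hγ => ?_
      rw [hl γ hγ, D.lab_of_le (restrict_le t _) (by rwa [hh])]
    rw [this]
    exact restrict_le _ _

theorem lab_restrict (D : Labelling T B) {t : T} {β γ : Ordinal.{u}} (hβ : β ≤ nodeHeight t)
    (hγ : γ < β) : D.lab (restrict t β) γ = D.lab t γ :=
  (D.lab_of_le (restrict_le t β) (by rwa [nodeHeight_restrict hβ])).symm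

theorem graft_mono (D : Labelling T B) {s y y' : T} (h : nodeHeight s ≤ nodeHeight y)
    (hy : y ≤ y') : D.graft s y ≤ D.graft s y' := by
  have hy' := h.trans (nodeHeight_mono hy)
  rw [D.le_iff, D.nodeHeight_graft h, D.nodeHeight_graft hy']
  refine ⟨nodeHeight_mono hy, fun γ hγ => ?_⟩
  rcases lt_or_ge γ (nodeHeight s) with h1 | h1
  · rw [D.lab_of_le (D.le_graft h) h1, D.lab_of_le (D.le_graft hy') h1]
  · rw [D.lab_graft h1 hγ, D.lab_graft h1 (hγ.trans_le (nodeHeight_mono hy)),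
      D.lab_of_le hy hγ]

theorem graft_of_nodeHeight_eq (D : Labelling T B) {s t : T} (h : nodeHeight s = nodeHeight t) :
    D.graft s t = s :=
  (eq_of_le_of_nodeHeight_eq (D.le_graft h.le) (by rw [D.nodeHeight_graft h.le, h])).symm

theorem graft_of_le (D : Labelling T B) {s t : T} (h : s ≤ t) : D.graft s t = t := by
  have hh := nodeHeight_mono h
  refine D.ext (D.nodeHeight_graft hh) fun γ hγ => ?_
  rw [D.nodeHeight_graft hh] at hγ
  rcases lt_or_ge γ (nodeHeight s) with h1 | h1
  · rw [D.lab_of_le (D.le_graft hh) h1, D.lab_of_le h h1]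
  · exact D.lab_graft h1 hγ

end Labelling

variable (D : Labelling T B) (e : T → ℕ) [Nonempty V] (F : ℕ → B → V)

/-- The labels of the quotient of `T` which is given by the partitions `F k` of the set `B` of
labels. The partition of the labels of the immediate successors of a node is chosen by means of
the code of the class of the node, that is, the least code of an element of the class. -/
noncomputable def colLab (t : T) : Ordinal.{u} → V := fun γ =>
  open Classical in
  if _h : γ < nodeHeight t then
    -- Both recursive calls concern nodes of height `γ`, which is below the height of `t`.
    F (sInf {j | ∃ s : T, ∃ _ : nodeHeight s = γ, colLab s = colLab (restrict t γ) ∧ e s = j})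
      (D.lab t γ)
  -- The constant default lets label functions of nodes of equal height be compared as a whole.
  else Classical.arbitrary V
termination_by nodeHeight t
decreasing_by
  · simp_all
  · rwa [nodeHeight_restrict (le_of_lt (by assumption))]

/-- The index of the partition that is used above the node `t`. -/
noncomputable def rowIndex (t : T) : ℕ :=
  sInf {j | ∃ s : T, ∃ _ : nodeHeight s = nodeHeight t, colLab D e F s = colLab D e F t ∧ e s = j}

theorem colLab_of_lt {t : T} {γ : Ordinal.{u}} (h : γ < nodeHeight t) :
    colLab D e F t γ = F (rowIndex D e F (restrict t γ)) (D.lab t γ) := by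
  rw [colLab, dif_pos h, rowIndex, nodeHeight_restrict h.le]

theorem colLab_of_ge {t : T} {γ : Ordinal.{u}} (h : nodeHeight t ≤ γ) :
    colLab D e F t γ = Classical.arbitrary V := by
  rw [colLab, dif_neg h.not_gt]

theorem colLab_of_le {s t : T} {γ : Ordinal.{u}} (h : s ≤ t) (hγ : γ < nodeHeight s) :
    colLab D e F t γ = colLab D e F s γ := by
  rw [colLab_of_lt D e F hγ, colLab_of_lt D e F (hγ.trans_le (nodeHeight_mono h)),
    restrict_of_le h hγ.le, D.lab_of_le h hγ]

theorem colLab_restrict {t : T} {β γ : Ordinal.{u}} (hβ : β ≤ nodeHeight t) (hγ : γ < β) :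
    colLab D e F (restrict t β) γ = colLab D e F t γ :=
  (colLab_of_le D e F (restrict_le t β) (by rwa [nodeHeight_restrict hβ])).symm

-- The row index is the code of an actual member of the class, and codes are injective on levels.
-- Thus distinct classes on a level use distinct rows, which is what the independence of the matrix
-- requires.
variable {e} in
theorem rowIndex_inj (he : ∀ s t, nodeHeight s = nodeHeight t → e s = e t → s = t) {s t : T}
    (hst : nodeHeight s = nodeHeight t) (h : rowIndex D e F s = rowIndex D e F t) :
    colLab D e F s = colLab D e F t := by
  have key : ∀ t : T, ∃ s : T, nodeHeight s = nodeHeight t ∧ colLab D e F s = colLab D e F t ∧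
      e s = rowIndex D e F t := by
    intro t
    obtain ⟨s, h1, h2⟩ := Nat.sInf_mem (s := {j | ∃ s : T, ∃ _ : nodeHeight s = nodeHeight t,
      colLab D e F s = colLab D e F t ∧ e s = j}) ⟨_, t, rfl, rfl, rfl⟩
    exact ⟨s, h1, h2⟩
  obtain ⟨s', h1, h2, h3⟩ := key s
  obtain ⟨t', h4, h5, h6⟩ := key t
  rw [← h2, ← h5, he s' t' (by rw [h1, h4, hst]) (by rw [h3, h6, h])]

/-- The equivalence relation on `T` given by the partitions `F`. -/
def colSetoid : Setoid T where
  r s t := nodeHeight s = nodeHeight t ∧ colLab D e F s = colLab D e F t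
  iseqv := ⟨fun _ => ⟨rfl, rfl⟩, fun h => ⟨h.1.symm, h.2.symm⟩,
    fun h h' => ⟨h.1.trans h'.1, h.2.trans h'.2⟩⟩

/-- The quotient of `T` given by the partitions `F`. -/
def ColTree : Type u := Quotient (colSetoid D e F)

namespace ColTree

/-- The class of a node. -/
def mk (t : T) : ColTree D e F := Quotient.mk (colSetoid D e F) t

theorem mk_surjective : Function.Surjective (mk D e F) := Quotient.mk_surjective

variable {D e F}

/-- The height of a class. -/
noncomputable def height : ColTree D e F → Ordinal.{u} := Quotient.lift nodeHeight fun _ _ h => h.1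

/-- The labels of a class. -/
noncomputable def lab : ColTree D e F → Ordinal.{u} → V :=
  Quotient.lift (colLab D e F) fun _ _ h => h.2

theorem ext {x y : ColTree D e F} (h : height x = height y)
    (h' : ∀ γ < height x, lab x γ = lab y γ) : x = y := by
  obtain ⟨s, rfl⟩ := mk_surjective D e F x
  obtain ⟨t, rfl⟩ := mk_surjective D e F y
  refine Quotient.sound ⟨h, funext fun γ => ?_⟩
  rcases lt_or_ge γ (nodeHeight s) with h1 | h1
  · exact h' γ h1
  · rw [colLab_of_ge D e F h1, colLab_of_ge D e F (le_of_eq_of_le (show nodeHeight t = nodeHeight s from h.symm) h1)]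

instance instPartialOrder : PartialOrder (ColTree D e F) where
  le x y := height x ≤ height y ∧ ∀ γ < height x, lab x γ = lab y γ
  le_refl x := ⟨le_rfl, fun _ _ => rfl⟩
  le_trans x y z h h' := ⟨h.1.trans h'.1, fun γ hγ => (h.2 γ hγ).trans (h'.2 γ (hγ.trans_le h.1))⟩
  le_antisymm x y h h' := ext (le_antisymm h.1 h'.1) h.2

theorem mk_mono {s t : T} (h : s ≤ t) : mk D e F s ≤ mk D e F t :=
  ⟨nodeHeight_mono h, fun _ hγ => (colLab_of_le D e F h hγ).symm⟩

theorem height_lt_of_lt {x y : ColTree D e F} (h : x < y) : height x < height y := by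
  refine lt_of_le_of_ne h.le.1 fun hh => h.ne (ext hh h.le.2)

theorem exists_lt_height_eq {x : ColTree D e F} {β : Ordinal.{u}} (h : β < height x) :
    ∃ y < x, height y = β := by
  obtain ⟨t, rfl⟩ := mk_surjective D e F x
  have hβ : nodeHeight (restrict t β) = β := nodeHeight_restrict (le_of_lt h)
  refine ⟨mk D e F (restrict t β), lt_of_le_of_ne (mk_mono (restrict_le _ _)) fun hc => ?_, hβ⟩
  exact h.ne (hβ.symm.trans (congrArg height hc))

instance instIsTree : IsTree (ColTree D e F) := by
  refine IsTree.of_wellFounded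
    (Subrelation.wf (fun {x y} => height_lt_of_lt) (InvImage.wf height Ordinal.lt_wf)) ?_
  intro t a b ha hb
  rcases lt_trichotomy (height a) (height b) with h | h | h
  · exact Or.inl (lt_of_le_of_ne ⟨h.le, fun γ hγ =>
      (ha.le.2 γ hγ).trans (hb.le.2 γ (hγ.trans h)).symm⟩ (by rintro rfl; exact h.ne rfl))
  · exact Or.inr (Or.inl (ext h fun γ hγ => (ha.le.2 γ hγ).trans (hb.le.2 γ (h ▸ hγ)).symm))
  · exact Or.inr (Or.inr (lt_of_le_of_ne ⟨h.le, fun γ hγ =>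
      (hb.le.2 γ hγ).trans (ha.le.2 γ (hγ.trans h)).symm⟩ (by rintro rfl; exact h.ne rfl)))

theorem nodeHeight_eq_height (x : ColTree D e F) : nodeHeight x = height x :=
  nodeHeight_unique (fun _ _ => height_lt_of_lt) (fun _ _ => exists_lt_height_eq) x

theorem nodeHeight_mk (t : T) : nodeHeight (mk D e F t) = nodeHeight t := nodeHeight_eq_height _

theorem mk_eq_mk {s t : T} : mk D e F s = mk D e F t ↔
    nodeHeight s = nodeHeight t ∧ colLab D e F s = colLab D e F t :=
  ⟨fun h => Quotient.exact h, fun h => Quotient.sound h⟩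

theorem rowIndex_congr {s t : T} (h : mk D e F s = mk D e F t) :
    rowIndex D e F s = rowIndex D e F t := by
  rw [mk_eq_mk] at h
  rw [rowIndex, rowIndex, h.1, h.2]

theorem mk_restrict_congr {s t : T} (h : mk D e F s = mk D e F t) {β : Ordinal.{u}}
    (hβ : β ≤ nodeHeight s) : mk D e F (restrict s β) = mk D e F (restrict t β) := by
  rw [mk_eq_mk] at h
  have hβ' : β ≤ nodeHeight t := h.1 ▸ hβ
  refine ext ((nodeHeight_restrict hβ).trans (nodeHeight_restrict hβ').symm) fun γ hγ => ?_
  have hγ' : γ < β := (nodeHeight_restrict hβ) ▸ hγ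
  change colLab D e F _ γ = colLab D e F _ γ
  rw [colLab_restrict D e F hβ hγ', colLab_restrict D e F hβ' hγ', h.2]

theorem mk_le_mk_iff_restrict {s t : T} : mk D e F s ≤ mk D e F t ↔
    nodeHeight s ≤ nodeHeight t ∧ mk D e F (restrict t (nodeHeight s)) = mk D e F s := by
  constructor
  · intro h
    refine ⟨h.1, ext (nodeHeight_restrict h.1) fun γ hγ => ?_⟩
    have hγ' : γ < nodeHeight s := lt_of_lt_of_eq hγ (nodeHeight_restrict h.1)
    exact (colLab_restrict D e F h.1 hγ').trans (h.2 γ hγ').symm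
  · rintro ⟨h1, h2⟩
    rw [← h2]
    exact mk_mono (restrict_le _ _)

/-- Two nodes are equivalent if they have equivalent restrictions and a common tail. -/
theorem mk_eq_of_tail {s t : T} {β : Ordinal.{u}} (hst : nodeHeight s = nodeHeight t)
    (hβ : β ≤ nodeHeight s) (h : mk D e F (restrict s β) = mk D e F (restrict t β))
    (htail : ∀ γ, β ≤ γ → γ < nodeHeight s → D.lab s γ = D.lab t γ) :
    mk D e F s = mk D e F t := by
  have hβ' : β ≤ nodeHeight t := hst ▸ hβ
  refine ext hst fun γ => ?_
  change γ < nodeHeight s → colLab D e F s γ = colLab D e F t γ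
  induction γ using WellFoundedLT.induction with
  | _ γ ih =>
  intro hγ
  have hγ' : γ < nodeHeight t := hst ▸ hγ
  rcases lt_or_ge γ β with h1 | h1
  · rw [← colLab_restrict D e F hβ h1, ← colLab_restrict D e F hβ' h1, (mk_eq_mk.1 h).2]
  · rw [colLab_of_lt D e F hγ, colLab_of_lt D e F hγ', htail γ h1 hγ]
    congr 1
    -- Equal class labels below `γ` put both restrictions into the same class, so both nodes use the
    -- same row at `γ`.
    refine rowIndex_congr (ext ((nodeHeight_restrict hγ.le).trans
      (nodeHeight_restrict hγ'.le).symm) fun δ hδ => ?_)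
    have hδ' : δ < γ := (nodeHeight_restrict hγ.le) ▸ hδ
    change colLab D e F _ δ = colLab D e F _ δ
    rw [colLab_restrict D e F hγ.le hδ', colLab_restrict D e F hγ'.le hδ']
    exact ih δ hδ' (hδ'.trans hγ)

/-- Two nodes of successor height are equivalent if their predecessors are and the last labels
coincide. -/
theorem mk_eq_of_succ {s t : T} {β : Ordinal.{u}} (hs : nodeHeight s = β + 1)
    (ht : nodeHeight t = β + 1) (h : mk D e F (restrict s β) = mk D e F (restrict t β))
    (hlast : colLab D e F s β = colLab D e F t β) : mk D e F s = mk D e F t := by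
  have hβs : β ≤ nodeHeight s := hs ▸ le_self_add
  have hβt : β ≤ nodeHeight t := ht ▸ le_self_add
  refine ext (hs.trans ht.symm) fun γ hγ => ?_
  change colLab D e F s γ = colLab D e F t γ
  have hγ' : γ ≤ β := Order.lt_add_one_iff.1 (hs ▸ hγ)
  rcases hγ'.eq_or_lt with rfl | h1
  · exact hlast
  · rw [← colLab_restrict D e F hβs h1, ← colLab_restrict D e F hβt h1, (mk_eq_mk.1 h).2]

theorem colLab_snoc (t : T) (b : B) :
    colLab D e F (D.snoc t b) (nodeHeight t) = F (rowIndex D e F t) b := by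
  rw [colLab_of_lt D e F (by rw [D.nodeHeight_snoc]; exact lt_add_one _),
    restrict_eq_of_le (D.le_snoc t b), D.lab_snoc]

theorem mk_covBy_mk_snoc (t : T) (b : B) : mk D e F t ⋖ mk D e F (D.snoc t b) := by
  rw [covBy_iff_nodeHeight, nodeHeight_mk, nodeHeight_mk, D.nodeHeight_snoc]
  exact ⟨mk_mono (D.le_snoc t b), rfl⟩

variable (D e F) in
theorem ccc (hT : CCC T) : CCC (ColTree D e F) :=
  hT.of_rel (fun x t => mk D e F t = x) (mk_surjective D e F)
    (by rintro _ _ s t rfl rfl h; exact mk_mono h)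

variable (D e F) in
theorem treeHeight_eq (hT : treeHeight T = Ordinal.omega 1) :
    treeHeight (ColTree D e F) = Ordinal.omega 1 := by
  refine treeHeight_eq_of (fun x => ?_) fun α hα => ?_
  · obtain ⟨t, rfl⟩ := mk_surjective D e F x
    rw [nodeHeight_mk, ← hT]
    exact nodeHeight_lt_treeHeight (by rw [hT]; exact (Ordinal.omega_pos 1).ne') t
  · obtain ⟨t, ht⟩ := exists_nodeHeight_eq (T := T) (hT ▸ hα)
    exact ⟨mk D e F t, by rw [nodeHeight_mk, ht]⟩

theorem branching [Nontrivial V] (hF : ∀ k, Function.Surjective (F k)) (x : ColTree D e F) :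
    {y | x ⋖ y}.Nontrivial := by
  obtain ⟨t, rfl⟩ := mk_surjective D e F x
  obtain ⟨v, w, hvw⟩ := exists_pair_ne V
  obtain ⟨b, rfl⟩ := hF (rowIndex D e F t) v
  obtain ⟨c, rfl⟩ := hF (rowIndex D e F t) w
  refine ⟨_, mk_covBy_mk_snoc t b, _, mk_covBy_mk_snoc t c, fun h => hvw ?_⟩
  exact (colLab_snoc t b).symm.trans ((congrFun (mk_eq_mk.1 h).2 _).trans (colLab_snoc t c))

theorem isNormal [Nontrivial V] (hF : ∀ k, Function.Surjective (F k)) (hT : IsNormal T)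
    (hh : treeHeight T = Ordinal.omega 1) : IsNormal (ColTree D e F) where
  root := by
    obtain ⟨r, hr, -⟩ := hT.root
    have hr0 := nodeHeight_eq_zero_iff.2 hr
    refine ⟨mk D e F r, nodeHeight_eq_zero_iff.1 (by rw [nodeHeight_mk, hr0]), fun y hy => ?_⟩
    have hy0 := nodeHeight_eq_zero_iff.2 hy
    rw [nodeHeight_eq_height] at hy0
    exact ext (hy0.trans hr0.symm) fun γ hγ => absurd (hy0 ▸ hγ) not_lt_zero
  branching s _ := branching hF s
  extend := by
    intro x α h1 h2
    obtain ⟨t, rfl⟩ := mk_surjective D e F x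
    rw [nodeHeight_mk] at h1
    obtain ⟨s, hs, rfl⟩ := hT.extend t α h1 (by rwa [hh, ← treeHeight_eq D e F hh])
    refine ⟨mk D e F s, lt_of_le_of_ne (mk_mono hs.le) fun h => ?_, nodeHeight_mk s⟩
    exact h1.ne (mk_eq_mk.1 h).1
  limit_unique := by
    have aux : ∀ x y : ColTree D e F, Order.IsSuccLimit (height x) → Set.Iio x ⊆ Set.Iio y →
        x ≤ y := by
      intro x y hx hxy
      have key : ∀ γ < height x, γ < height y ∧ lab x γ = lab y γ := by
        intro γ hγ
        obtain ⟨z, hz, hz'⟩ := exists_lt_height_eq (hx.add_one_lt hγ)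
        have hγz : γ < height z := hz' ▸ lt_add_one γ
        have hzy : z < y := hxy hz
        exact ⟨hγz.trans (height_lt_of_lt hzy), (hz.le.2 γ hγz).symm.trans (hzy.le.2 γ hγz)⟩
      exact ⟨le_of_forall_lt fun γ hγ => (key γ hγ).1, fun γ hγ => (key γ hγ).2⟩
    intro x y hx hy hxy
    rw [nodeHeight_eq_height] at hx hy
    exact le_antisymm (aux x y hx hxy.subset) (aux y x hy hxy.symm.subset)

/-- The last label is a bijection from the immediate successors of a class onto `V`. -/
theorem isAlephZeroSplitting [Countable V] [Infinite V] (hF : ∀ k, Function.Surjective (F k)) :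
    IsAlephZeroSplitting (ColTree D e F) := by
  intro x _
  obtain ⟨t, rfl⟩ := mk_surjective D e F x
  have hinj : Function.Injective
      fun y : {y | mk D e F t ⋖ y} => lab y.1 (nodeHeight t) := by
    rintro ⟨y, hy⟩ ⟨z, hz⟩ h
    obtain ⟨s, rfl⟩ := mk_surjective D e F y
    obtain ⟨s', rfl⟩ := mk_surjective D e F z
    obtain ⟨hy1, hy2⟩ := covBy_iff_nodeHeight.1 hy
    obtain ⟨hz1, hz2⟩ := covBy_iff_nodeHeight.1 hz
    simp only [nodeHeight_mk] at hy2 hz2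
    refine Subtype.ext (mk_eq_of_succ hy2 hz2 ?_ h)
    rw [(mk_le_mk_iff_restrict.1 hy1).2, (mk_le_mk_iff_restrict.1 hz1).2]
  have hsurj : Function.Surjective
      fun y : {y | mk D e F t ⋖ y} => lab y.1 (nodeHeight t) := by
    intro v
    obtain ⟨b, rfl⟩ := hF (rowIndex D e F t) v
    exact ⟨⟨_, mk_covBy_mk_snoc t b⟩, colLab_snoc t b⟩
  have := hinj.countable
  have := Infinite.of_surjective _ hsurj
  exact Cardinal.mk_eq_aleph0 _

theorem isSouslin [Nontrivial V] (hF : ∀ k, Function.Surjective (F k)) (hT : IsSouslin T) :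
    IsSouslin (ColTree D e F) where
  height_eq := treeHeight_eq D e F hT.height_eq
  ccc := ccc D e F hT.ccc
  branch_countable := chain_countable_of_ccc (ccc D e F hT.ccc) (branching hF)

end ColTree

end ColumnTree

/-! ### Trees of height `ω₁`. -/

theorem lt_omega_one_add_one {α : Ordinal.{u}} (h : α < Ordinal.omega 1) :
    α + 1 < Ordinal.omega 1 :=
  (Cardinal.isSuccLimit_omega 1).add_one_lt h

theorem one_add_lt_omega_one {α : Ordinal.{u}} (h : α < Ordinal.omega 1) :
    1 + α < Ordinal.omega 1 := by
  rcases lt_or_ge α Ordinal.omega0 with h' | h'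
  · exact (Ordinal.isPrincipal_add_omega0 Ordinal.one_lt_omega0 h').trans
      Ordinal.omega0_lt_omega_one
  · rwa [Ordinal.one_add_of_omega0_le h']

section HeightOmegaOne

variable {T : Type u} [PartialOrder T] [IsTree T]

theorem nodeHeight_lt_omega_one (hh : treeHeight T = Ordinal.omega 1) (t : T) :
    nodeHeight t < Ordinal.omega 1 :=
  hh ▸ nodeHeight_lt_treeHeight (by rw [hh]; exact (Ordinal.omega_pos 1).ne') t

theorem IsNormal.nontrivial_covers (hT : IsNormal T) (hh : treeHeight T = Ordinal.omega 1)
    (t : T) : {s : T | t ⋖ s}.Nontrivial :=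
  hT.branching t (by rw [hh]; exact lt_omega_one_add_one (nodeHeight_lt_omega_one hh t))

theorem IsNormal.not_isMax (hT : IsNormal T) (hh : treeHeight T = Ordinal.omega 1)
    (t : T) : ¬ IsMax t := by
  obtain ⟨s, hs, -⟩ := hT.nontrivial_covers hh t
  exact fun h => h.not_lt (CovBy.lt hs)

end HeightOmegaOne

/-! ### Tree sums. -/

namespace TreeSum

variable {ι : Type} {S : ι → Type u}

/-- The canonical map of a summand into a tree sum. -/
def inj (i : ι) (x : S i) : TreeSum S := ((⟨i, x⟩ : Σ i, S i) : WithBot (Σ i, S i))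

theorem eq_bot_or_inj (z : TreeSum S) : z = ⊥ ∨ ∃ i x, z = inj i x := by
  induction z using WithBot.recBotCoe with
  | bot => exact Or.inl rfl
  | coe p => exact Or.inr ⟨p.1, p.2, rfl⟩

theorem inj_injective {i : ι} {x y : S i} (h : inj (S := S) i x = inj i y) : x = y := by
  have := WithBot.coe_injective h
  cases this
  rfl

theorem fst_eq_of_inj_eq {i j : ι} {x : S i} {y : S j} (h : inj (S := S) i x = inj j y) :
    i = j := congrArg Sigma.fst (WithBot.coe_injective h)

variable [∀ i, PartialOrder (S i)]

theorem bot_lt_inj (i : ι) (x : S i) : ⊥ < inj (S := S) i x := WithBot.bot_lt_coe _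

theorem inj_le_inj {i : ι} {x y : S i} : inj (S := S) i x ≤ inj i y ↔ x ≤ y := by
  rw [inj, inj, WithBot.coe_le_coe, Sigma.mk_le_mk_iff]

theorem inj_lt_inj {i : ι} {x y : S i} : inj (S := S) i x < inj i y ↔ x < y := by
  rw [inj, inj, WithBot.coe_lt_coe, Sigma.mk_lt_mk_iff]

theorem inj_le_iff {i : ι} {x : S i} {z : TreeSum S} :
    inj i x ≤ z ↔ ∃ y, z = inj i y ∧ x ≤ y := by
  constructor
  · intro h
    rcases eq_bot_or_inj z with rfl | ⟨j, y, rfl⟩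
    · exact absurd h (bot_lt_inj i x).not_ge
    · have h' := WithBot.coe_le_coe.1 h
      cases h' with
      | fiber => exact ⟨_, rfl, by assumption⟩
  · rintro ⟨y, rfl, h⟩
    exact inj_le_inj.2 h

theorem lt_inj_iff {i : ι} {x : S i} {z : TreeSum S} :
    z < inj i x ↔ z = ⊥ ∨ ∃ y, z = inj i y ∧ y < x := by
  constructor
  · intro h
    rcases eq_bot_or_inj z with rfl | ⟨j, y, rfl⟩
    · exact Or.inl rfl
    · obtain ⟨y', h1, h2⟩ := inj_le_iff.1 h.le
      obtain rfl := fst_eq_of_inj_eq h1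
      exact Or.inr ⟨_, rfl, inj_lt_inj.1 h⟩
  · rintro (rfl | ⟨y, rfl, h⟩)
    · exact bot_lt_inj i x
    · exact inj_lt_inj.2 h

theorem ccc [Countable ι] (hS : ∀ i, CCC (S i)) : CCC (TreeSum S) := by
  intro A hA
  have hsub : A ⊆ {⊥} ∪ ⋃ i, inj i '' {x : S i | inj i x ∈ A} := by
    intro z hz
    rcases eq_bot_or_inj z with rfl | ⟨i, x, rfl⟩
    · exact Or.inl rfl
    · exact Or.inr (Set.mem_iUnion.2 ⟨i, x, hz, rfl⟩)
  refine Set.Countable.mono hsub ((Set.countable_singleton _).union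
    (Set.countable_iUnion fun i => Set.Countable.image (hS i _ ?_) _))
  intro x hx y hy hne hle
  exact hA hx hy (fun h => hne (inj_injective h)) (inj_le_inj.2 hle)

variable [∀ i, IsTree (S i)]

theorem nodeHeight_bot : nodeHeight (⊥ : TreeSum S) = 0 := nodeHeight_eq_zero_iff.2 isMin_bot

theorem nodeHeight_inj (i : ι) (x : S i) : nodeHeight (inj (S := S) i x) = 1 + nodeHeight x := by
  refine nodeHeight_unique (T := TreeSum S)
    (h := WithBot.recBotCoe 0 fun p : Σ i, S i => 1 + nodeHeight p.2) (fun s t h => ?_)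
    (fun t β h => ?_) (inj i x)
  · rcases eq_bot_or_inj t with rfl | ⟨j, y, rfl⟩
    · exact absurd h not_lt_bot
    · rcases lt_inj_iff.1 h with rfl | ⟨z, rfl, hz⟩
      · exact lt_of_lt_of_le zero_lt_one le_self_add
      · exact (add_lt_add_iff_left 1).2 (nodeHeight_lt_of_lt hz)
  · rcases eq_bot_or_inj t with rfl | ⟨j, y, rfl⟩
    · exact absurd h not_lt_zero
    · have h : β < 1 + nodeHeight y := h
      rcases eq_or_ne β 0 with rfl | h0
      · exact ⟨⊥, bot_lt_inj j y, rfl⟩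
      · rw [← Ordinal.add_sub_cancel_of_le (Order.one_le_iff_pos.2 (pos_iff_ne_zero.2 h0)),
          add_lt_add_iff_left] at h
        obtain ⟨z, hz, hz'⟩ := exists_lt_nodeHeight_eq h
        refine ⟨inj j z, inj_lt_inj.2 hz, ?_⟩
        change 1 + nodeHeight z = β
        rw [hz', Ordinal.add_sub_cancel_of_le (Order.one_le_iff_pos.2 (pos_iff_ne_zero.2 h0))]

theorem inj_covBy_inj {i : ι} {x y : S i} : inj (S := S) i x ⋖ inj i y ↔ x ⋖ y := by
  rw [covBy_iff_nodeHeight, covBy_iff_nodeHeight, inj_le_inj, nodeHeight_inj, nodeHeight_inj,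
    add_assoc, add_right_inj]

theorem bot_covBy_inj {i : ι} {x : S i} : ⊥ ⋖ inj (S := S) i x ↔ IsMin x := by
  rw [covBy_iff_nodeHeight, nodeHeight_inj, nodeHeight_bot, ← nodeHeight_eq_zero_iff, zero_add]
  constructor
  · rintro ⟨-, h⟩
    exact (add_right_inj 1).1 (h.trans (add_zero 1).symm)
  · intro h
    exact ⟨bot_le, by rw [h, add_zero]⟩

theorem inj_covBy_iff {i : ι} {x : S i} {z : TreeSum S} :
    inj i x ⋖ z ↔ ∃ y, z = inj i y ∧ x ⋖ y := by
  constructor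
  · intro h
    obtain ⟨y, rfl, -⟩ := inj_le_iff.1 h.le
    exact ⟨y, rfl, inj_covBy_inj.1 h⟩
  · rintro ⟨y, rfl, h⟩
    exact inj_covBy_inj.2 h

theorem treeHeight_eq [Nonempty ι] (hh : ∀ i, treeHeight (S i) = Ordinal.omega 1) :
    treeHeight (TreeSum S) = Ordinal.omega 1 := by
  refine treeHeight_eq_of (fun z => ?_) fun α hα => ?_
  · rcases eq_bot_or_inj z with rfl | ⟨i, x, rfl⟩
    · rw [nodeHeight_bot]
      exact Ordinal.omega_pos 1
    · rw [nodeHeight_inj]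
      exact one_add_lt_omega_one (nodeHeight_lt_omega_one (hh i) x)
  · rcases eq_or_ne α 0 with rfl | h0
    · exact ⟨⊥, nodeHeight_bot⟩
    · obtain ⟨i⟩ := ‹Nonempty ι›
      have h1 := Ordinal.add_sub_cancel_of_le (Order.one_le_iff_pos.2 (pos_iff_ne_zero.2 h0))
      obtain ⟨x, hx⟩ := exists_nodeHeight_eq (T := S i) (α := α - 1)
        (by rw [hh i]; exact (Ordinal.sub_le_self _ _).trans_lt hα)
      exact ⟨inj i x, by rw [nodeHeight_inj, hx, h1]⟩

theorem nontrivial_covers [Nontrivial ι] (hn : ∀ i, IsNormal (S i))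
    (hh : ∀ i, treeHeight (S i) = Ordinal.omega 1) (z : TreeSum S) : {y | z ⋖ y}.Nontrivial := by
  rcases eq_bot_or_inj z with rfl | ⟨i, x, rfl⟩
  · obtain ⟨i, j, hij⟩ := exists_pair_ne ι
    obtain ⟨r, hr, -⟩ := (hn i).root
    obtain ⟨r', hr', -⟩ := (hn j).root
    exact ⟨_, bot_covBy_inj.2 hr, _, bot_covBy_inj.2 hr', fun h => hij (fst_eq_of_inj_eq h)⟩
  · obtain ⟨y, hy, y', hy', hne⟩ := (hn i).nontrivial_covers (hh i) x
    exact ⟨_, inj_covBy_inj.2 hy, _, inj_covBy_inj.2 hy', fun h => hne (inj_injective h)⟩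

theorem isSuccLimit_of_one_add {α : Ordinal.{u}} (h : Order.IsSuccLimit (1 + α)) :
    Order.IsSuccLimit α := by
  rcases Ordinal.isSuccLimit_add_iff.1 h with h | ⟨-, h⟩
  · exact h
  · rw [← zero_add (1 : Ordinal)] at h
    exact absurd h (Order.not_isSuccLimit_succ 0)

theorem isNormal [Nontrivial ι] (hn : ∀ i, IsNormal (S i))
    (hh : ∀ i, treeHeight (S i) = Ordinal.omega 1) : IsNormal (TreeSum S) where
  root := ⟨⊥, isMin_bot, fun z hz => hz.eq_bot⟩
  branching z _ := nontrivial_covers hn hh z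
  extend := by
    intro z α h1 h2
    rw [treeHeight_eq hh] at h2
    have h0 := Ordinal.add_sub_cancel_of_le
      (Order.one_le_iff_pos.2 (lt_of_le_of_lt zero_le h1))
    have h2' : α - 1 < Ordinal.omega 1 := (Ordinal.sub_le_self _ _).trans_lt h2
    rcases eq_bot_or_inj z with rfl | ⟨i, x, rfl⟩
    · obtain ⟨i⟩ := (inferInstance : Nonempty ι)
      obtain ⟨x, hx⟩ := exists_nodeHeight_eq (T := S i) (α := α - 1) (by rwa [hh i])
      exact ⟨inj i x, bot_lt_inj i x, by rw [nodeHeight_inj, hx, h0]⟩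
    · rw [nodeHeight_inj, ← h0, add_lt_add_iff_left] at h1
      obtain ⟨y, hy, hy'⟩ := (hn i).extend x _ h1 (by rwa [hh i])
      exact ⟨inj i y, inj_lt_inj.2 hy, by rw [nodeHeight_inj, hy', h0]⟩
  limit_unique := by
    intro z w hz hw hzw
    rcases eq_bot_or_inj z with rfl | ⟨i, x, rfl⟩
    · rw [nodeHeight_bot] at hz
      exact absurd isMin_bot hz.1
    rcases eq_bot_or_inj w with rfl | ⟨j, y, rfl⟩
    · rw [nodeHeight_bot] at hw
      exact absurd isMin_bot hw.1
    rw [nodeHeight_inj] at hz hw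
    have hx := isSuccLimit_of_one_add hz
    have hy := isSuccLimit_of_one_add hw
    -- A common predecessor other than the new root shows that both nodes lie in the same summand.
    obtain ⟨r, hr, -⟩ := exists_lt_nodeHeight_eq (t := x) (β := 0)
      (pos_iff_ne_zero.2 fun h => hx.1 (by rw [h]; exact isMin_bot))
    have hr' : inj i r ∈ Set.Iio (inj (S := S) j y) := hzw ▸ inj_lt_inj.2 hr
    obtain ⟨r', hr', -⟩ := inj_le_iff.1 (le_of_lt hr')
    obtain rfl := fst_eq_of_inj_eq hr'
    congr 1
    refine (hn _).limit_unique _ _ hx hy (Set.ext fun r => ?_)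
    have := Set.ext_iff.1 hzw (inj _ r)
    simpa only [Set.mem_Iio, inj_lt_inj] using this

theorem isSouslin [Countable ι] [Nontrivial ι] (hn : ∀ i, IsNormal (S i))
    (hS : ∀ i, IsSouslin (S i)) : IsSouslin (TreeSum S) where
  height_eq := treeHeight_eq fun i => (hS i).height_eq
  ccc := ccc fun i => (hS i).ccc
  branch_countable := chain_countable_of_ccc (ccc fun i => (hS i).ccc)
    (nontrivial_covers hn fun i => (hS i).height_eq)

/-- The immediate successors of the new root are the roots of the summands, so infinitely many
summands are needed. -/
theorem isAlephZeroSplitting [Countable ι] [Infinite ι] (hn : ∀ i, IsNormal (S i))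
    (hs : ∀ i, IsAlephZeroSplitting (S i)) : IsAlephZeroSplitting (TreeSum S) := by
  intro z hz
  rcases eq_bot_or_inj z with rfl | ⟨i, x, rfl⟩
  · choose r hr hr' using fun i => (hn i).root
    have : {t : TreeSum S | ⊥ ⋖ t} = Set.range fun i => inj i (r i) := by
      ext t
      constructor
      · intro ht
        rcases eq_bot_or_inj t with rfl | ⟨i, x, rfl⟩
        · exact absurd (CovBy.lt ht) (lt_irrefl _)
        · exact ⟨i, by dsimp only; rw [hr' i x (bot_covBy_inj.1 ht)]⟩
      · rintro ⟨i, rfl⟩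
        exact bot_covBy_inj.2 (hr i)
    rw [this]
    have hinj : Function.Injective fun i => inj i (r i) := fun i j h => fst_eq_of_inj_eq h
    have := (Set.countable_range fun i => inj i (r i)).to_subtype
    have := (Equiv.ofInjective _ hinj).infinite_iff.1 inferInstance
    exact Cardinal.mk_eq_aleph0 _
  · have : {t : TreeSum S | inj i x ⋖ t} = inj i '' {y | x ⋖ y} := by
      ext t
      rw [Set.mem_ofPred_eq, inj_covBy_iff]
      constructor
      · rintro ⟨y, rfl, h⟩
        exact ⟨y, h, rfl⟩
      · rintro ⟨y, h, rfl⟩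
        exact ⟨y, rfl, h⟩
    rw [this, Cardinal.mk_image_eq fun _ _ => inj_injective]
    refine hs i x fun hmax => hz fun w hw => ?_
    obtain ⟨y, rfl, hy⟩ := inj_le_iff.1 hw
    exact inj_le_inj.2 (hmax hy)

end TreeSum

/-! ### Chain conditions for products of quotients, and their failure. -/

section Products

variable {T : Type u} [PartialOrder T] [IsTree T] {B V ι : Type} [Nonempty V]
  {D : Labelling T B} {e : T → ℕ} {f : ι → ℕ → B → V}

open ColTree

/-- Classes of nodes above distinct classes on a fixed level, taken from quotients whose
partitions are independent, have representatives with a common tail. -/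
theorem exists_common_tail (he : ∀ s t, nodeHeight s = nodeHeight t → e s = e t → s = t)
    {I : Type*} [Finite I] [Nonempty I] {i : I → ι} (hi : Solvable f i) {α : Ordinal.{u}}
    {t₀ : I → T} (ht₀ : ∀ a, nodeHeight (t₀ a) = α)
    (hne : ∀ a b, i a = i b → mk D e (f (i a)) (t₀ a) = mk D e (f (i a)) (t₀ b) → a = b)
    {β : Ordinal.{u}} (hβ : α ≤ β) (x : I → T) (hx : ∀ a, nodeHeight (x a) = β)
    (hle : ∀ a, mk D e (f (i a)) (t₀ a) ≤ mk D e (f (i a)) (x a)) :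
    ∃ y, nodeHeight y = β ∧ ∀ a, mk D e (f (i a)) (D.graft (t₀ a) y) = mk D e (f (i a)) (x a) := by
  induction β using WellFoundedLT.induction generalizing x with
  | _ β ih =>
  have a₀ : I := Classical.arbitrary I
  have hrestr : ∀ γ, α ≤ γ → γ ≤ β → ∀ a, mk D e (f (i a)) (t₀ a) ≤
      mk D e (f (i a)) (restrict (x a) γ) := by
    intro γ h1 h2 a
    have hγ : γ ≤ nodeHeight (x a) := by rwa [hx]
    rw [mk_le_mk_iff_restrict, nodeHeight_restrict hγ, ht₀, restrict_restrict hγ h1]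
    refine ⟨h1, ?_⟩
    rw [← ht₀ a]
    exact (mk_le_mk_iff_restrict.1 (hle a)).2
  rcases hβ.eq_or_lt with rfl | hβ
  · refine ⟨x a₀, hx a₀, fun a => ?_⟩
    rw [D.graft_of_nodeHeight_eq (by rw [ht₀, hx])]
    exact eq_of_le_of_nodeHeight_eq (hle a) (by rw [nodeHeight_mk, nodeHeight_mk, ht₀, hx])
  rcases Ordinal.zero_or_succ_or_isSuccLimit β with rfl | ⟨γ, rfl⟩ | hlim
  · exact absurd hβ not_lt_zero
  · rw [Order.succ_eq_add_one] at *
    have hγ : α ≤ γ := Order.lt_add_one_iff.1 hβ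
    have hγx : ∀ a, γ ≤ nodeHeight (x a) := fun a => by rw [hx]; exact le_self_add
    obtain ⟨y, hy, hyx⟩ := ih γ (lt_add_one γ) hγ (fun a => restrict (x a) γ)
      (fun a => nodeHeight_restrict (hγx a)) (hrestr γ hγ le_self_add)
    have hty : ∀ a, nodeHeight (t₀ a) ≤ nodeHeight y := fun a => by rw [ht₀, hy]; exact hγ
    -- The next label `b` must have the prescribed image under one partition for each `a`. Within a
    -- column the rows are distinct: equal rows would give equal classes of the grafted nodes, and
    -- by restriction to `α` equal classes of the `t₀ a`.
    obtain ⟨b, hb⟩ := hi (fun a => rowIndex D e (f (i a)) (D.graft (t₀ a) y)) (by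
      intro a b hab hk
      refine hne a b hab ?_
      rw [← hab] at hk
      have h1 := mk_eq_mk.2 ⟨(by rw [D.nodeHeight_graft (hty a), D.nodeHeight_graft (hty b)]),
        rowIndex_inj D (f (i a)) he (by
          rw [D.nodeHeight_graft (hty a), D.nodeHeight_graft (hty b)]) hk⟩
      have h2 := mk_restrict_congr h1 (β := α)
        (by rw [D.nodeHeight_graft (hty a), hy]; exact hγ)
      rwa [restrict_eq (D.le_graft (hty a)) (ht₀ a), restrict_eq (D.le_graft (hty b)) (ht₀ b)]
        at h2) (fun a => colLab D e (f (i a)) (x a) γ)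
    have hyb := D.le_snoc y b
    have hh : nodeHeight (D.snoc y b) = γ + 1 := by rw [D.nodeHeight_snoc, hy]
    refine ⟨D.snoc y b, hh, fun a => ?_⟩
    have hle' : nodeHeight (t₀ a) ≤ nodeHeight (D.snoc y b) :=
      (hty a).trans (nodeHeight_mono hyb)
    have hhg : nodeHeight (D.graft (t₀ a) (D.snoc y b)) = γ + 1 := by
      rw [D.nodeHeight_graft hle', hh]
    have hres : restrict (D.graft (t₀ a) (D.snoc y b)) γ = D.graft (t₀ a) y :=
      restrict_eq (D.graft_mono (hty a) hyb) (by rw [D.nodeHeight_graft (hty a), hy])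
    refine mk_eq_of_succ hhg (hx a) (by rw [hres, hyx]) ?_
    rw [colLab_of_lt D e _ (by rw [hhg]; exact lt_add_one γ), hres, ← hb a,
      D.lab_graft (by rw [ht₀]; exact hγ) (by rw [hh]; exact lt_add_one γ)]
    congr 1
    rw [← hy]
    exact D.lab_snoc y b
  -- At a limit, the finitely many `x a` share the tail of `x a₀` from some `ε < β` on. The
  -- induction hypothesis is used at `ε`, and this tail is then put on top.
  · have htail : ∀ a, ∃ δ : Set.Iio β, ∀ γ, δ.1 ≤ γ → γ < β →
        D.lab (x a) γ = D.lab (x a₀) γ := by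
      intro a
      obtain ⟨δ, h1, h2⟩ := D.tail (s := x a) (t := x a₀) (by rw [hx, hx]) (by rwa [hx])
      rw [hx] at h1 h2
      exact ⟨⟨δ, h1⟩, h2⟩
    choose δ hδ using htail
    have : Nonempty (Set.Iio β) := ⟨⟨α, hβ⟩⟩
    obtain ⟨M, hM⟩ := Finite.exists_le δ
    obtain ⟨ε, hεα, hεM, hεβ⟩ : ∃ ε, α ≤ ε ∧ M.1 ≤ ε ∧ ε < β :=
      ⟨max α M.1, le_max_left _ _, le_max_right _ _, max_lt hβ M.2⟩
    have hεx : ∀ a, ε ≤ nodeHeight (x a) := fun a => by rw [hx]; exact hεβ.le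
    obtain ⟨y, hy, hyx⟩ := ih ε hεβ hεα (fun a => restrict (x a) ε)
      (fun a => nodeHeight_restrict (hεx a)) (hrestr ε hεα hεβ.le)
    have hty : ∀ a, nodeHeight (t₀ a) ≤ nodeHeight y := fun a => by rw [ht₀, hy]; exact hεα
    have hyx₀ : nodeHeight y ≤ nodeHeight (x a₀) := by rw [hy]; exact hεx a₀
    have hyle := D.le_graft hyx₀
    have hh : nodeHeight (D.graft y (x a₀)) = β := by rw [D.nodeHeight_graft hyx₀, hx]
    refine ⟨_, hh, fun a => ?_⟩
    have hle' : nodeHeight (t₀ a) ≤ nodeHeight (D.graft y (x a₀)) :=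
      (hty a).trans (nodeHeight_mono hyle)
    have hhg : nodeHeight (D.graft (t₀ a) (D.graft y (x a₀))) = β := by
      rw [D.nodeHeight_graft hle', hh]
    have hres : restrict (D.graft (t₀ a) (D.graft y (x a₀))) ε = D.graft (t₀ a) y :=
      restrict_eq (D.graft_mono (hty a) hyle) (by rw [D.nodeHeight_graft (hty a), hy])
    refine mk_eq_of_tail (β := ε) (by rw [hhg, hx]) (by rw [hhg]; exact hεβ.le)
      (by rw [hres, hyx]) fun γ h1 h2 => ?_
    rw [hhg] at h2
    rw [D.lab_graft (by rw [ht₀]; exact hεα.trans h1) (by rwa [hh]),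
      D.lab_graft (by rwa [hy]) (by rwa [hx]), hδ a γ (le_trans (hM a) (hεM.trans h1)) h2]

/-- Products of trees that embed into the cones of independent quotients of a tree with the c.c.c.
satisfy the c.c.c. -/
theorem ccc_treeProd (he : ∀ s t, nodeHeight s = nodeHeight t → e s = e t → s = t) (hT : CCC T)
    {I : Type*} [Finite I] [Nonempty I] {i : I → ι} (hi : Solvable f i) {α : Ordinal.{u}}
    {t₀ : I → T} (ht₀ : ∀ a, nodeHeight (t₀ a) = α)
    (hne : ∀ a b, i a = i b → mk D e (f (i a)) (t₀ a) = mk D e (f (i a)) (t₀ b) → a = b)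
    {X : I → Type u} [∀ a, PartialOrder (X a)] [∀ a, IsTree (X a)]
    (φ : ∀ a, X a → ColTree D e (f (i a))) (hφ : ∀ a x y, φ a x ≤ φ a y → x ≤ y)
    (hφ₀ : ∀ a x, mk D e (f (i a)) (t₀ a) ≤ φ a x)
    (hφh : ∀ a x, nodeHeight (φ a x) = α + nodeHeight x) : CCC (TreeProd X) := by
  -- A point of the product is related to every single node whose grafts onto the `t₀ a` represent
  -- all its coordinates.
  refine hT.of_rel (fun x y => ∀ a, α ≤ nodeHeight y ∧
    mk D e (f (i a)) (D.graft (t₀ a) y) = φ a (x.1 a)) (fun x => ?_) ?_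
  · have a₀ : I := Classical.arbitrary I
    choose z hz using fun a => mk_surjective D e (f (i a)) (φ a (x.1 a))
    obtain ⟨y, hy, hyz⟩ := exists_common_tail he hi ht₀ hne
      (le_self_add : α ≤ α + nodeHeight (x.1 a₀)) z
      (fun a => by rw [← nodeHeight_mk (D := D) (e := e) (F := f (i a)), hz, hφh, x.2 a a₀])
      (fun a => by rw [hz]; exact hφ₀ a _)
    exact ⟨y, fun a => ⟨by rw [hy]; exact le_self_add, by rw [hyz, hz]⟩⟩
  · intro x x' y y' h h' hy a
    refine hφ a _ _ ?_
    rw [← (h a).2, ← (h' a).2]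
    exact mk_mono (D.graft_mono (by rw [ht₀]; exact (h a).1) hy)

/-- All factors use the same column, so only the solvability of constant families is needed. -/
theorem ColTree.isFree (he : ∀ s t, nodeHeight s = nodeHeight t → e s = e t → s = t)
    (hT : CCC T) {i : ι} (hi : ∀ (I : Type u) [Finite I], Solvable f fun _ : I => i)
    (hn : IsNormal (ColTree D e (f i))) (hh : treeHeight (ColTree D e (f i)) = Ordinal.omega 1) :
    IsFree (ColTree D e (f i)) where
  normal := hn
  height_eq := hh
  prod_ccc := by
    rintro P ⟨s₀, hs₀⟩ ⟨α, hα⟩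
    have : Nonempty {s // s ∈ P} := ⟨⟨s₀, hs₀⟩⟩
    choose t₀ ht₀ using fun a : {s // s ∈ P} => mk_surjective D e (f i) a.1
    refine ccc_treeProd he hT (hi {s // s ∈ P}) (t₀ := t₀) (α := α) (fun a => ?_)
      (fun a b _ h => ?_) (fun a x => x.1) (fun a x y h => h) (fun a x => ?_) (fun a x => ?_)
    · rw [← nodeHeight_mk (D := D) (e := e) (F := f i), ht₀]
      exact hα _ a.2
    · rw [ht₀, ht₀] at h
      exact Subtype.ext h
    · rw [ht₀]
      exact x.2
    · rw [← hα _ a.2]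
      exact (nodeHeight_Ici x).symm

theorem TreeSum.isNFree [Countable ι]
    (he : ∀ s t, nodeHeight s = nodeHeight t → e s = e t → s = t) (hT : CCC T) {n : ℕ}
    (hn : 1 ≤ n) (hi : ∀ (I : Type u) [Finite I], Nat.card I = n → ∀ i : I → ι, Solvable f i) :
    IsNFree (TreeSum fun i => ColTree D e (f i)) n := by
  rintro P hP ⟨α, hα⟩
  by_cases hbot : ⊥ ∈ P
  -- The level of `⊥` contains no other node, so the product has a single factor, the whole sum.
  · have hs : ∀ s ∈ P, s = ⊥ := by
      intro s hs
      have h0 := (hα s hs).trans (hα ⊥ hbot).symm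
      rw [TreeSum.nodeHeight_bot, nodeHeight_eq_zero_iff] at h0
      exact h0.eq_bot
    refine (TreeSum.ccc fun i => ColTree.ccc D e (f i) hT).of_rel
      (fun x y => (x.1 ⟨⊥, hbot⟩ : TreeSum fun i => ColTree D e (f i)) = y)
      (fun x => ⟨_, rfl⟩) ?_
    rintro x x' _ _ rfl rfl h ⟨s, hsP⟩
    obtain rfl := hs s hsP
    exact h
  · have hex : ∀ a : {s // s ∈ P}, ∃ i t,
        a.1 = TreeSum.inj (S := fun i => ColTree D e (f i)) i (mk D e (f i) t) := by
      intro a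
      rcases TreeSum.eq_bot_or_inj a.1 with h | ⟨i, x, h⟩
      · exact absurd (h ▸ a.2) hbot
      · obtain ⟨t, rfl⟩ := mk_surjective D e (f i) x
        exact ⟨i, t, h⟩
    choose i t₀ hit using hex
    have hcard : Nat.card {s // s ∈ P} = n := by simp [hP]
    have : Nonempty {s // s ∈ P} := by
      obtain ⟨s, hs⟩ := Finset.card_pos.1 (hP ▸ hn)
      exact ⟨⟨s, hs⟩⟩
    have hheight : ∀ a, 1 + nodeHeight (t₀ a) = α := fun a => by
      rw [← hα _ a.2, hit, TreeSum.nodeHeight_inj, nodeHeight_mk]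
    have hex' : ∀ (a : {s // s ∈ P}) (x : Set.Ici a.1), ∃ y : ColTree D e (f (i a)),
        x.1 = TreeSum.inj (S := fun i => ColTree D e (f i)) (i a) y ∧
          mk D e (f (i a)) (t₀ a) ≤ y := by
      intro a x
      exact TreeSum.inj_le_iff.1 (le_of_eq_of_le (hit a).symm (Set.mem_Ici.1 x.2))
    choose φ hφ hφ' using hex'
    -- The new root raises heights by a `1` on the left, so level `α` of the sum is level `α - 1` of
    -- the summands.
    refine ccc_treeProd he hT (hi _ hcard i) (t₀ := t₀) (α := α - 1) (fun a => ?_)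
      (fun a b hab h => ?_) φ (fun a x y h => ?_) hφ' (fun a x => ?_)
    · rw [← hheight a, Ordinal.add_sub_cancel]
    · refine Subtype.ext ?_
      rw [hit a, hit b, h]
      exact congrArg (fun j => TreeSum.inj (S := fun i => ColTree D e (f i)) j
        (mk D e (f j) (t₀ b))) hab
    · refine Subtype.coe_le_coe.1 ?_
      rw [hφ a x, hφ a y]
      exact TreeSum.inj_le_inj.2 h
    · have h1 := nodeHeight_Ici x
      rw [hφ a x, TreeSum.nodeHeight_inj, hα _ a.2, ← hheight a, add_assoc, add_right_inj] at h1
      rw [← hheight a, Ordinal.add_sub_cancel, h1]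

/-- If the partitions chosen from the given quotients separate the labels then the quotients
separate the nodes. -/
theorem le_of_forall_mk_le {I : Type*} [Nonempty I] {i : I → ι}
    (hi : ∀ k : I → ℕ, Function.Injective fun b a => f (i a) (k a) b) {s t : T}
    (h : ∀ a, mk D e (f (i a)) s ≤ mk D e (f (i a)) t) : s ≤ t := by
  have hh : nodeHeight s ≤ nodeHeight t := (h (Classical.arbitrary I)).1
  refine D.le_iff.2 ⟨hh, fun γ => ?_⟩
  induction γ using WellFoundedLT.induction with
  | _ γ ih =>
  intro hγ
  have hγ' := hγ.trans_le hh
  -- Labels that agree below `γ` give equal restrictions, hence equal rows at `γ` in every column;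
  -- the chosen partitions then separate the labels at `γ`.
  have hres : restrict s γ = restrict t γ := by
    refine D.ext ((nodeHeight_restrict hγ.le).trans (nodeHeight_restrict hγ'.le).symm)
      fun δ hδ => ?_
    rw [nodeHeight_restrict hγ.le] at hδ
    rw [D.lab_restrict hγ.le hδ, D.lab_restrict hγ'.le hδ]
    exact ih δ hδ (hδ.trans hγ)
  refine hi (fun a => rowIndex D e (f (i a)) (restrict s γ)) (funext fun a => ?_)
  have h1 := (h a).2 γ hγ
  change colLab D e _ s γ = colLab D e _ t γ at h1
  rwa [colLab_of_lt D e _ hγ, colLab_of_lt D e _ hγ', ← hres] at h1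

theorem nonempty_orderIso_treeProd
    (he : ∀ s t, nodeHeight s = nodeHeight t → e s = e t → s = t) (hT : IsNormal T)
    {I : Type} [Finite I] [Nonempty I] {i : I → ι} (hinj : Function.Injective i)
    (hsolv : Solvable f i) (hi : ∀ k : I → ℕ, Function.Injective fun b a => f (i a) (k a) b) :
    Nonempty (T ≃o TreeProd fun a => ColTree D e (f (i a))) := by
  obtain ⟨r, hr, -⟩ := hT.root
  let Φ : T ↪o TreeProd fun a => ColTree D e (f (i a)) := OrderEmbedding.ofMapLEIff
    (fun t => ⟨fun a => mk D e (f (i a)) t, fun a b => by rw [nodeHeight_mk, nodeHeight_mk]⟩)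
    (fun s t => ⟨fun h => le_of_forall_mk_le hi h, fun h a => mk_mono h⟩)
  have hr0 : nodeHeight r = 0 := nodeHeight_eq_zero_iff.2 hr
  have hmin : ∀ t : T, r ≤ t := fun t => D.le_iff.2
    ⟨by rw [hr0]; exact zero_le, fun γ hγ => absurd (hr0 ▸ hγ) not_lt_zero⟩
  refine ⟨OrderIso.ofSurjective Φ fun x => ?_⟩
  have a₀ : I := Classical.arbitrary I
  choose z hz using fun a => mk_surjective D e (f (i a)) (x.1 a)
  -- Over the root grafting changes nothing, so the common tail is itself a preimage.
  obtain ⟨y, -, hyz⟩ := exists_common_tail (D := D) he hsolv (t₀ := fun _ => r) (fun _ => hr0)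
    (fun a b h _ => hinj h) (β := nodeHeight (x.1 a₀)) zero_le z
    (fun a => by rw [← nodeHeight_mk (D := D) (e := e) (F := f (i a)), hz, x.2 a a₀])
    (fun a => mk_mono (hmin _))
  refine ⟨y, Subtype.ext (funext fun a => ?_)⟩
  have h := hyz a
  rw [D.graft_of_le (hmin y), hz] at h
  exact h

theorem IsSouslin.not_countable_Ici (hT : IsSouslin T) (hn : IsNormal T) (t : T) :
    ¬ (Set.Ici t).Countable := by
  intro hc
  have hIic : (Set.Iic t).Countable :=
    hT.branch_countable _ (fun a ha b hb _ => IsTree.comparable_of_le ha hb)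
      (fun a b hab ha => hab.trans ha)
  refine not_countable_Iio_omega_one (((hIic.image nodeHeight).union
    (hc.image nodeHeight)).mono fun α hα => ?_)
  rcases le_or_gt α (nodeHeight t) with h | h
  · exact Or.inl ⟨_, restrict_le t α, nodeHeight_restrict h⟩
  · obtain ⟨s, hs, hs'⟩ := hn.extend t α h (by rw [hT.height_eq]; exact hα)
    exact Or.inr ⟨s, hs.le, hs'⟩

/-- Each `w ≥ t` gives a point of the product: the first `n` coordinates are the classes of `w`
followed by `b`, the last one is the class of the graft of `t'` onto `w` followed by a label that
its partition separates from `b`. If the points of `w < w'` were comparable in this order, the first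
`n` coordinates would force `w'` to continue `w` with `b`, against the last coordinate. The
uncountable cone of `t` thus yields an uncountable antichain. -/
theorem TreeSum.not_isNFree_succ (hT : IsSouslin T) (hn : IsNormal T) {n : ℕ} (hn0 : 1 ≤ n)
    {i : Option (Fin n) → ι}
    (hi : ∀ k : Fin n → ℕ, Function.Injective fun b m => f (i (some m)) (k m) b) (b : B)
    (hb : ∀ k, ∃ c, f (i none) k c ≠ f (i none) k b) {t t' : T}
    (htt' : nodeHeight t = nodeHeight t') {t₀ : Option (Fin n) → T}
    (ht₀ : ∀ m, t₀ (some m) = t) (ht₀' : t₀ none = t')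
    (hinj : Function.Injective fun a =>
      TreeSum.inj (S := fun i => ColTree D e (f i)) (i a) (mk D e (f (i a)) (t₀ a))) :
    ¬ IsNFree (TreeSum fun i => ColTree D e (f i)) (n + 1) := by
  classical
  intro hfree
  have hht : ∀ a, nodeHeight (t₀ a) = nodeHeight t := by
    rintro (_ | m)
    · rw [ht₀', htt']
    · rw [ht₀]
  have hccc := hfree (Finset.univ.map ⟨_, hinj⟩) (by simp) ⟨1 + nodeHeight t, by
    intro s hs
    obtain ⟨a, -, rfl⟩ := Finset.mem_map.1 hs
    change nodeHeight (TreeSum.inj _ _) = _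
    rw [TreeSum.nodeHeight_inj, nodeHeight_mk, hht]⟩
  generalize hP : Finset.univ.map ⟨_, hinj⟩ = P at hccc
  have hmem : ∀ a, TreeSum.inj (S := fun i => ColTree D e (f i)) (i a)
      (mk D e (f (i a)) (t₀ a)) ∈ P := fun a => by
    rw [← hP]
    exact Finset.mem_map.2 ⟨a, Finset.mem_univ _, rfl⟩
  have hex : ∀ s : {s // s ∈ P}, ∃ a, TreeSum.inj (S := fun i => ColTree D e (f i)) (i a)
      (mk D e (f (i a)) (t₀ a)) = s.1 := by
    rintro ⟨s, hs⟩
    rw [← hP] at hs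
    obtain ⟨a, -, ha⟩ := Finset.mem_map.1 hs
    exact ⟨a, ha⟩
  choose ρ hρ using hex
  choose c hc using hb
  let lst : T → Option (Fin n) → B := fun w a =>
    a.elim (c (rowIndex D e (f (i none)) (D.graft t' w))) fun _ => b
  let nd : T → Option (Fin n) → T := fun w a => D.snoc (D.graft (t₀ a) w) (lst w a)
  have hnd : ∀ w, t ≤ w → ∀ a, t₀ a ≤ nd w a ∧ nodeHeight (nd w a) = nodeHeight w + 1 := by
    intro w hw a
    have h1 : nodeHeight (t₀ a) ≤ nodeHeight w := by rw [hht]; exact nodeHeight_mono hw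
    exact ⟨(D.le_graft h1).trans (D.le_snoc _ _), by
      rw [D.nodeHeight_snoc, D.nodeHeight_graft h1]⟩
  have hle : ∀ (w : Set.Ici t) (s : {s // s ∈ P}), TreeSum.inj
      (S := fun i => ColTree D e (f i)) (i (ρ s)) (mk D e (f (i (ρ s))) (nd w.1 (ρ s))) ∈
        Set.Ici s.1 := by
    intro w s
    rw [Set.mem_Ici, ← hρ s]
    exact TreeSum.inj_le_inj.2 (mk_mono (hnd w.1 w.2 _).1)
  have hheight : ∀ s ∈ P, nodeHeight s = 1 + nodeHeight t := by
    intro s hs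
    rw [← show _ = s from hρ ⟨s, hs⟩, TreeSum.nodeHeight_inj, nodeHeight_mk, hht]
  let z : Set.Ici t → TreeProd fun s : {s // s ∈ P} => Set.Ici s.1 := fun w =>
    ⟨fun s => ⟨_, hle w s⟩, fun s s' => (nodeHeight_Ici_eq_iff
      ((hheight _ s.2).trans (hheight _ s'.2).symm) _ _).2 (by
        simp only [TreeSum.nodeHeight_inj, nodeHeight_mk, (hnd w.1 w.2 _).2])⟩
  have hzle : ∀ w w' : Set.Ici t, z w ≤ z w' → ∀ a,
      mk D e (f (i a)) (nd w.1 a) ≤ mk D e (f (i a)) (nd w'.1 a) := by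
    intro w w' h a
    have h1 : TreeSum.inj (S := fun i => ColTree D e (f i)) (i (ρ ⟨_, hmem a⟩))
        (mk D e (f (i (ρ ⟨_, hmem a⟩))) (nd w.1 (ρ ⟨_, hmem a⟩))) ≤
        TreeSum.inj (S := fun i => ColTree D e (f i)) (i (ρ ⟨_, hmem a⟩))
        (mk D e (f (i (ρ ⟨_, hmem a⟩))) (nd w'.1 (ρ ⟨_, hmem a⟩))) := h ⟨_, hmem a⟩
    have h2 : ρ ⟨_, hmem a⟩ = a := hinj (hρ ⟨_, hmem a⟩)
    rw [h2] at h1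
    exact (TreeSum.inj_le_inj (S := fun i => ColTree D e (f i))).1 h1
  have hzeq : ∀ w w' : Set.Ici t, z w ≤ z w' → w = w' := by
    intro w w' h
    have hmk := hzle w w' h
    have : Nonempty (Fin n) := ⟨⟨0, hn0⟩⟩
    have h1 : ∀ (m : Fin n) (w : Set.Ici t), nd w.1 (some m) = D.snoc w.1 b := by
      intro m w
      change D.snoc (D.graft (t₀ (some m)) w.1) b = _
      rw [ht₀, D.graft_of_le w.2]
    -- The first `n` columns jointly separate labels, so they recover the order of `T`.
    have h2 : D.snoc w.1 b ≤ D.snoc w'.1 b :=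
      le_of_forall_mk_le (i := fun m => i (some m)) hi fun m => by
        simpa only [h1] using hmk (some m)
    have h3 := nodeHeight_mono h2
    rw [D.nodeHeight_snoc, D.nodeHeight_snoc, ← Order.succ_eq_add_one, ← Order.succ_eq_add_one,
      Order.succ_le_succ_iff] at h3
    have h4 : w.1 ≤ w'.1 := le_of_le_of_nodeHeight_le ((D.le_snoc _ _).trans h2)
      (D.le_snoc _ _) h3
    by_contra hne
    have h5 : nodeHeight w.1 < nodeHeight w'.1 :=
      nodeHeight_lt_of_lt (lt_of_le_of_ne h4 fun h => hne (Subtype.ext h))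
    have hlab : D.lab w'.1 (nodeHeight w.1) = b := by
      rw [← D.lab_of_le (D.le_snoc w'.1 b) h5, D.lab_of_le h2
        (by rw [D.nodeHeight_snoc]; exact lt_add_one _), D.lab_snoc]
    have hw : nodeHeight t' ≤ nodeHeight w.1 := htt' ▸ nodeHeight_mono w.2
    have hw' := hw.trans h3
    have h6 := (hmk none).2 (nodeHeight w.1)
      ((lt_add_one _).trans_eq (hnd w.1 w.2 none).2.symm)
    change colLab D e (f (i none)) _ _ = colLab D e (f (i none)) _ _ at h6
    have h7 : nd w.1 none = D.snoc (D.graft t' w.1)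
        (c (rowIndex D e (f (i none)) (D.graft t' w.1))) := by
      change D.snoc (D.graft (t₀ none) w.1) _ = _
      rw [ht₀']
      rfl
    have h8 : D.graft t' w'.1 ≤ nd w'.1 none := by
      change _ ≤ D.snoc (D.graft (t₀ none) w'.1) _
      rw [ht₀']
      exact D.le_snoc _ _
    have h9 := colLab_snoc (D := D) (e := e) (F := f (i none)) (D.graft t' w.1)
      (c (rowIndex D e (f (i none)) (D.graft t' w.1)))
    rw [D.nodeHeight_graft hw] at h9
    have h10 : nodeHeight w.1 < nodeHeight (D.graft t' w'.1) := by rwa [D.nodeHeight_graft hw']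
    -- In the last coordinate both sides use the row of the graft of `t'` onto `w`, once with the
    -- separated label and once with `b`.
    rw [h7, h9, colLab_of_le D e _ h8 h10, colLab_of_lt D e _ h10, D.lab_graft hw h5, hlab,
      restrict_eq (D.graft_mono hw h4) (D.nodeHeight_graft hw)] at h6
    exact hc _ h6
  have hanti : IsAntichain (· ≤ ·) (Set.range z) := by
    rintro _ ⟨w, rfl⟩ _ ⟨w', rfl⟩ hne h
    exact hne (congrArg z (hzeq w w' h))
  have hcount := hccc _ hanti
  have hzinj : Function.Injective z := fun w w' h => hzeq w w' h.le
  have := hcount.to_subtype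
  exact hT.not_countable_Ici hn t
    (Set.countable_coe_iff.1 ((Set.rangeFactorization_injective.2 hzinj).countable))

end Products

/-! ### Surjectivity of the partitions, and the main theorem. -/

theorem partitionMap_surjective {ι : Type} {n : ℕ} (col : ι → Fin n) (σ : Fin n → ι)
    (hσ : ∀ m, col (σ m) = m) (i : ι) (k : ℕ) : Function.Surjective (partitionMap col i k) := by
  classical
  intro v
  -- Column `i` replaces the one of its colour in `σ`, so it belongs to a family with one column of
  -- each colour.
  have h : ∀ m, col (Function.update σ (col i) i m) = m := by
    intro m
    rcases eq_or_ne m (col i) with rfl | hm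
    · rw [Function.update_self]
    · rw [Function.update_of_ne hm, hσ]
  obtain ⟨x, hx⟩ := (partitionMap_bijective col _ h fun _ => k).2 fun _ => v
  have := congrFun hx (col i)
  simp only [Function.update_self] at this
  exact ⟨x, this⟩

theorem exists_partitionMap_ne {ι : Type} {n : ℕ} [Nonempty ι] (col : ι → Fin n) (σ : Fin n → ι)
    (hσ : ∀ m, col (σ m) = m) (i : ι) (k : ℕ) (b : Fin n → WordSpace ι) :
    ∃ c, partitionMap col i k c ≠ partitionMap col i k b := by
  obtain ⟨v, hv⟩ := exists_ne (partitionMap col i k b)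
  obtain ⟨c, rfl⟩ := partitionMap_surjective col σ hσ i k v
  exact ⟨c, hv⟩

theorem IsStronglyHomogeneous.nonempty_labelling {T : Type u} [PartialOrder T] [IsTree T]
    (hhom : IsStronglyHomogeneous T) (hnormal : IsNormal T) (hsplit : IsAlephZeroSplitting T)
    (hh : treeHeight T = Ordinal.omega 1) (B : Type) [Countable B] [Infinite B] :
    Nonempty (Labelling T B) := by
  obtain ⟨C⟩ := hhom
  obtain ⟨r, -, -⟩ := hnormal.root
  have : Nonempty T := ⟨r⟩
  have he : ∀ s : T, Nonempty ({t : T | s ⋖ t} ≃ B) := by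
    intro s
    have h := hsplit s (hnormal.not_isMax hh s)
    have : Countable {t : T | s ⋖ t} := Cardinal.mk_le_aleph0_iff.1 h.le
    have : Infinite {t : T | s ⋖ t} := Cardinal.infinite_iff.2 h.ge
    exact nonempty_equiv_of_countable
  exact C.nonempty_labelling hnormal fun s => (he s).some

end SouslinTree

open SouslinTree
theorem mainTheorem4 (T : Type u) [PartialOrder T] [IsTree T]
    (hnormal : IsNormal T) (hsplit : IsAlephZeroSplitting T) (hsouslin : IsSouslin T)
    (hhom : IsStronglyHomogeneous T) :
    (∀ n : ℕ, 1 ≤ n →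
      ∃ (R : Type u) (_ : PartialOrder R) (_ : IsTree R),
        IsNormal R ∧ IsAlephZeroSplitting R ∧ IsSouslin R ∧
        IsNFree R n ∧ ¬ IsNFree R (n + 1)) ∧
    (∀ n : ℕ, 2 ≤ n →
      ∃ (S : Fin n → Type u) (_ : ∀ i, PartialOrder (S i)) (_ : ∀ i, IsTree (S i)),
        (∀ i, IsNormal (S i) ∧ IsAlephZeroSplitting (S i) ∧ IsSouslin (S i) ∧ IsFree (S i)) ∧
        Nonempty (T ≃o TreeProd S) ∧
        IsNormal (TreeSum S) ∧ IsSouslin (TreeSum S) ∧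
        IsNFree (TreeSum S) n ∧ ¬ IsNFree (TreeSum S) (n + 1)) := by
  have hh := hsouslin.height_eq
  obtain ⟨e, he⟩ := exists_injOn_levels hsouslin.ccc
  obtain ⟨r, hr, -⟩ := hnormal.root
  constructor
  · intro n hn
    have : Nonempty (Fin n) := ⟨⟨0, hn⟩⟩
    -- Infinitely many columns of each colour make the root of the sum `ℵ₀`-splitting.
    let col : Fin n × ℕ → Fin n := Prod.fst
    let σ : Fin n → Fin n × ℕ := fun m => (m, 0)
    have hσ : ∀ m, col (σ m) = m := fun _ => rfl
    have hsurj := partitionMap_surjective col σ hσ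
    obtain ⟨D⟩ := hhom.nonempty_labelling hnormal hsplit hh (Fin n → WordSpace (Fin n × ℕ))
    have hSn := fun i => ColTree.isNormal (D := D) (e := e) (hsurj i) hnormal hh
    have hSs := fun i => ColTree.isSouslin (D := D) (e := e) (hsurj i) hsouslin
    refine ⟨TreeSum fun i => ColTree D e (partitionMap col i), inferInstance, inferInstance,
      TreeSum.isNormal hSn fun i => (hSs i).height_eq,
      TreeSum.isAlephZeroSplitting hSn fun i => ColTree.isAlephZeroSplitting (hsurj i),
      TreeSum.isSouslin hSn hSs,
      TreeSum.isNFree he hsouslin.ccc hn fun I _ hI i => solvable_of_card col hI i, ?_⟩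
    -- The additional column `(0, 1)` differs from all `(m, 0)`, so the roots of `n + 1` summands
    -- serve as the set of nodes.
    refine TreeSum.not_isNFree_succ (i := fun a => a.elim (⟨0, hn⟩, 1) σ) hsouslin hnormal hn
      (fun k => (partitionMap_bijective col σ hσ k).1) 0
      (fun k => exists_partitionMap_ne col σ hσ _ k 0) (t := r) (t' := r) rfl
      (t₀ := fun _ => r) (fun _ => rfl) rfl ?_
    intro a b hab
    have h := TreeSum.fst_eq_of_inj_eq hab
    rcases a with _ | a <;> rcases b with _ | b
    · rfl
    · exact absurd (Prod.ext_iff.1 h).2 one_ne_zero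
    · exact absurd (Prod.ext_iff.1 h).2 zero_ne_one
    · exact congrArg some (Prod.ext_iff.1 h).1
  · intro n hn
    have hn1 : 1 ≤ n := one_le_two.trans hn
    have : Nonempty (Fin n) := ⟨⟨0, hn1⟩⟩
    have : Nontrivial (Fin n) := Fin.nontrivial_iff_two_le.2 hn
    let col : Fin n → Fin n := id
    have hσ : ∀ m, col (id m) = m := fun _ => rfl
    have hsurj := partitionMap_surjective col id hσ
    obtain ⟨D⟩ := hhom.nonempty_labelling hnormal hsplit hh (Fin n → WordSpace (Fin n))
    have hSn := fun i => ColTree.isNormal (D := D) (e := e) (hsurj i) hnormal hh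
    have hSs := fun i => ColTree.isSouslin (D := D) (e := e) (hsurj i) hsouslin
    have hsep := fun k => (partitionMap_bijective col id hσ k).1
    refine ⟨fun i => ColTree D e (partitionMap col i), inferInstance, inferInstance,
      fun i => ⟨hSn i, ColTree.isAlephZeroSplitting (hsurj i), hSs i, ?_⟩, ?_,
      TreeSum.isNormal hSn fun i => (hSs i).height_eq, TreeSum.isSouslin hSn hSs,
      TreeSum.isNFree he hsouslin.ccc hn1 fun I _ hI i => solvable_of_card col hI i, ?_⟩
    · obtain ⟨m, hm⟩ := exists_ne i
      exact ColTree.isFree he hsouslin.ccc (fun I _ => solvable_of_ne col _ m fun _ => hm.symm)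
        (hSn i) (hSs i).height_eq
    · exact nonempty_orderIso_treeProd he hnormal Function.injective_id
        (solvable_of_leftInverse col id hσ) hsep
    -- With only `n` columns, column `0` is used twice. The label `c` is chosen so that the
    -- successors of the root with labels `0` and `c` have distinct classes there.
    · obtain ⟨c, hc⟩ := exists_partitionMap_ne col id hσ ⟨0, hn1⟩
        (rowIndex D e (partitionMap col ⟨0, hn1⟩) r) 0
      refine TreeSum.not_isNFree_succ (i := fun a => a.elim ⟨0, hn1⟩ id) hsouslin hnormal hn1
        hsep 0 (fun k => exists_partitionMap_ne col id hσ _ k 0)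
        (t := D.snoc r 0) (t' := D.snoc r c) (by rw [D.nodeHeight_snoc, D.nodeHeight_snoc])
        (t₀ := fun a => a.elim (D.snoc r c) fun _ => D.snoc r 0) (fun _ => rfl) rfl ?_
      have hne : ColTree.mk D e (partitionMap col ⟨0, hn1⟩) (D.snoc r c) ≠
          ColTree.mk D e (partitionMap col ⟨0, hn1⟩) (D.snoc r 0) := by
        intro h
        exact hc ((ColTree.colLab_snoc r c).symm.trans
          ((congrFun (ColTree.mk_eq_mk.1 h).2 _).trans (ColTree.colLab_snoc r 0)))
      intro a b hab
      have h := TreeSum.fst_eq_of_inj_eq hab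
      rcases a with _ | a <;> rcases b with _ | b
      · rfl
      · obtain rfl : ⟨0, hn1⟩ = b := h
        exact absurd (TreeSum.inj_injective hab) hne
      · obtain rfl : a = ⟨0, hn1⟩ := h
        exact absurd (TreeSum.inj_injective hab) hne.symm
      · exact congrArg some h
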